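/- All graphs are metric graphs with edges of length $1$; a simplicial graph is one without loops and multiple edges. A cycle of length $n\ge 1$ in a graph $\Gamma$ is a nondegenerate combinatorial map $f\colon C\to\Gamma$ from a circle $C$ subdivided into $n$ edges (each edge of $C$ is mapped isometrically onto an edge of $\Gamma$). The cycle is isometric if it is an isometric embedding, and, for $\xi\in(0,1)$, it is $\xi$-almost isometric if $d_\Gamma(f(p),f(q))\ge \xi\, n/2$ for every pair of antipodal points $p,q\in C$. A (nonempty) connected simplicial graph $\Gamma$ is shortcut if there is $\theta\in\mathbb N$ such that every isometric cycle of $\Gamma$ has length at most $\theta$; it is strongly shortcut if there are $\theta\in\mathbb N$ and $\xi\in(0,1)$ such that every $\xi$-almost isometric cycle of $\Gamma$ has length at most $\theta$. A group is shortcut (resp. strongly shortcut) if it acts properly and cocompactly, by graph automorphisms, on a shortcut (resp. strongly shortcut) graph. Theorem. Let $G$ be a shortcut (resp. strongly shortcut) group. Then there is a compact connected $2$-complex $X$ (a compact CW complex without cells of dimension greater than $2$) with $\pi_1(X)\cong G$ such that the $1$-skeleton of the universal cover $\widetilde X$, with the cell structure lifted from $X$, is a shortcut (resp. strongly shortcut)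 graph. In particular, $G$ is finitely presented. -/

import Mathlib

universe u v

namespace Shortcut

/-! ### Graphs, cycles and the two shortcut properties

A connected simplicial graph is a connected `SimpleGraph`, regarded as a geodesic metric graph all of
whose edges are copies of `[0, 1]`. -/

section Graphs

variable {V : Type v}

/-- A point of the metric graph `Γ` that lies on a (closed) edge: the point at distance `pos` from
the initial vertex of the oriented edge `dart`. -/
structure EdgePoint (Γ : SimpleGraph V) where
  dart : Γ.Dart
  pos : ℝ
  pos_mem : pos ∈ Set.Icc (0 : ℝ) 1

/-- The distance, in the metric graph, from a point of an edge to a vertex: a shortest path leaves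
the edge through one of its two ends. -/
noncomputable def EdgePoint.distVertex {Γ : SimpleGraph V} (p : EdgePoint Γ) (w : V) : ℝ :=
  min (p.pos + (Γ.dist p.dart.fst w : ℝ)) ((1 - p.pos) + (Γ.dist p.dart.snd w : ℝ))

open Classical in
/-- The distance in the metric graph between two points lying on edges. Two points of the same edge
are joined by a geodesic inside that edge (the second case is that of opposite orientations);
otherwise a shortest path reaches the second point through an end of its edge. -/
noncomputable def EdgePoint.dist {Γ : SimpleGraph V} (p q : EdgePoint Γ) : ℝ :=
  if p.dart = q.dart then |p.pos - q.pos|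
  else if p.dart = q.dart.symm then |p.pos - (1 - q.pos)|
  else min (p.distVertex q.dart.fst + q.pos) (p.distVertex q.dart.snd + (1 - q.pos))

/-- A cycle of length `n` in `Γ`: a nondegenerate combinatorial map to `Γ` from the circle
subdivided into `n` edges, given by the images of the `n` cyclically ordered vertices. -/
structure Cycle (Γ : SimpleGraph V) (n : ℕ) where
  vert : ZMod n → V
  adj : ∀ i : ZMod n, Γ.Adj (vert i) (vert (i + 1))

/-- The cycle as a map to the metric graph `Γ`, its domain being the circle `ℝ / nℤ` with vertices
the integers: the point with coordinate `x` is sent to the point at position `x - ⌊x⌋` on the edge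
joining the images of the vertices `⌊x⌋` and `⌊x⌋ + 1`. -/
noncomputable def Cycle.point {Γ : SimpleGraph V} {n : ℕ} (f : Cycle Γ n) (x : ℝ) : EdgePoint Γ where
  dart := ⟨(f.vert ((⌊x⌋ : ℤ) : ZMod n), f.vert (((⌊x⌋ : ℤ) : ZMod n) + 1)), f.adj _⟩
  pos := Int.fract x
  pos_mem := ⟨Int.fract_nonneg x, (Int.fract_lt_one x).le⟩

/-- A cycle is isometric if it is an isometric embedding of the circle of length `n`. -/
def Cycle.IsIsometric {Γ : SimpleGraph V} {n : ℕ} (f : Cycle Γ n) : Prop :=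
  ∀ x y : ℝ, (f.point x).dist (f.point y) =
    Dist.dist (x : AddCircle (n : ℝ)) (y : AddCircle (n : ℝ))

/-- A cycle of length `n` is `ξ`-almost isometric if the images of any two antipodal points of the
circle are at distance at least `ξ * (n / 2)`. -/
def Cycle.IsAlmostIsometric {Γ : SimpleGraph V} {n : ℕ} (f : Cycle Γ n) (ξ : ℝ) : Prop :=
  ∀ x : ℝ, ξ * ((n : ℝ) / 2) ≤ (f.point x).dist (f.point (x + (n : ℝ) / 2))

/-- A shortcut graph: connected, with a bound on the lengths of its isometric cycles. -/
def IsShortcutGraph (Γ : SimpleGraph V) : Prop :=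
  Γ.Connected ∧ ∃ θ : ℕ, ∀ n : ℕ, 1 ≤ n → ∀ f : Cycle Γ n, f.IsIsometric → n ≤ θ

/-- A strongly shortcut graph: connected, with a bound on the lengths of its `ξ`-almost isometric
cycles for some `ξ ∈ (0, 1)`. -/
def IsStronglyShortcutGraph (Γ : SimpleGraph V) : Prop :=
  Γ.Connected ∧ ∃ θ : ℕ, ∃ ξ : ℝ, 0 < ξ ∧ ξ < 1 ∧
    ∀ n : ℕ, 1 ≤ n → ∀ f : Cycle Γ n, f.IsAlmostIsometric ξ → n ≤ θ

end Graphs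

/-! ### Group actions and (strongly) shortcut groups -/

section Groups

variable {G : Type u} [Group G] {V : Type v} {Γ : SimpleGraph V}

/-- A cocompact action by graph automorphisms: the translates of some finite subgraph, spanned by a
finite set `S` of vertices, cover `Γ`. -/
def IsCocompactAction (φ : G →* (Γ ≃g Γ)) : Prop :=
  ∃ S : Finset V, (∀ v, ∃ g, φ g v ∈ S) ∧
    ∀ u v, Γ.Adj u v → ∃ g, φ g u ∈ S ∧ φ g v ∈ S

/-- A proper action by graph automorphisms: for every finite set `S` of vertices, only finitely many
group elements `g` satisfy `g S ∩ S ≠ ∅`. -/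
def IsProperAction (φ : G →* (Γ ≃g Γ)) : Prop :=
  ∀ S : Finset V, {g : G | ∃ v ∈ S, φ g v ∈ S}.Finite

/-- A group is shortcut if it acts properly and cocompactly on a shortcut graph.
(A graph on which `G` acts properly and cocompactly has a copy of itself in the universe of `G`.) -/
def IsShortcutGroup (G : Type u) [Group G] : Prop :=
  ∃ (V : Type u) (Γ : SimpleGraph V) (φ : G →* (Γ ≃g Γ)),
    IsShortcutGraph Γ ∧ IsProperAction φ ∧ IsCocompactAction φ

/-- A group is strongly shortcut if it acts properly and cocompactly on a strongly shortcut
graph. -/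
def IsStronglyShortcutGroup (G : Type u) [Group G] : Prop :=
  ∃ (V : Type u) (Γ : SimpleGraph V) (φ : G →* (Γ ≃g Γ)),
    IsStronglyShortcutGraph Γ ∧ IsProperAction φ ∧ IsCocompactAction φ

end Groups

/-! ### Compact 2-complexes and their universal covers -/

section Complexes

open Topology

/-- A (Hausdorff) CW complex is a compact 2-complex if it is compact and has no cells of dimension
greater than two. -/
structure IsCompactTwoComplex (X : Type u) [TopologicalSpace X]
    [CWComplex (Set.univ : Set X)] : Prop where
  t2 : T2Space X
  compact : CompactSpace X
  dim_le_two : ∀ n, 2 < n → IsEmpty (RelCWComplex.cell (Set.univ : Set X) n)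

/-- `p : E → X` is the universal cover of the CW complex `X`, with the cell structure of `E` being
the one lifted from `X`: the characteristic maps of the cells of `E` are lifts of characteristic
maps of cells of `X`. -/
structure IsUniversalCover {E X : Type u} [TopologicalSpace E] [TopologicalSpace X]
    [CWComplex (Set.univ : Set E)] [CWComplex (Set.univ : Set X)] (p : E → X) : Prop where
  t2 : T2Space E
  simplyConnected : SimplyConnectedSpace E
  isCoveringMap : IsCoveringMap p
  surjective : Function.Surjective p
  map_cell : ∀ (n : ℕ) (e : RelCWComplex.cell (Set.univ : Set E) n),
    ∃ c : RelCWComplex.cell (Set.univ : Set X) n,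
      Set.EqOn (p ∘ RelCWComplex.map n e) (RelCWComplex.map n c) (Metric.closedBall 0 1)

/-- The 1-skeleton of the CW complex `E` is a shortcut graph; in particular it is simplicial, that
is, it has no loops and no multiple edges. -/
def HasShortcutOneSkeleton (E : Type u) [TopologicalSpace E]
    [CWComplex (Set.univ : Set E)] : Prop :=
  (CWComplex.OneSkeletonGraph (Set.univ : Set E)).Simple ∧
    IsShortcutGraph (CWComplex.OneSkeletonGraph (Set.univ : Set E)).toSimpleGraph

/-- The 1-skeleton of the CW complex `E` is a strongly shortcut graph; in particular it is
simplicial. -/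
def HasStronglyShortcutOneSkeleton (E : Type u) [TopologicalSpace E]
    [CWComplex (Set.univ : Set E)] : Prop :=
  (CWComplex.OneSkeletonGraph (Set.univ : Set E)).Simple ∧
    IsStronglyShortcutGraph (CWComplex.OneSkeletonGraph (Set.univ : Set E)).toSimpleGraph

end Complexes

end Shortcut

namespace Shortcut

section CycleMetric

/-! ### Distances between points of cycles -/

/-! The given action is replaced by a free action on another graph with the same shortcut property,
and the short closed walks of that graph are then filled by discs.

Blow-up. Let a finite set `S` meet every vertex orbit of `Γ`. Each vertex `v` is replaced by the
triples `(g, s, c)` with `g s = v`, `s ∈ S` and `c` one of three colours; triples of different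
colours over adjacent vertices are joined. Left multiplication by `G` is free on vertices, the
colours exclude inversions of edges, and properness and cocompactness leave finitely many orbits of
edges. Writing `Δ` for the blow-up, `d_Γ ≤ d_Δ ≤ max d_Γ 3` (`dist_blowUp_le`), so long isometric
cycles project to isometric ones, and long almost isometric cycles to almost isometric ones with a
smaller constant. Hence both properties lift (`IsShortcutGraph.of_hom`,
`IsStronglyShortcutGraph.of_hom`). If `Γ` is a single vertex, then `G` is finite and `Γ` is
exchanged for one edge with the trivial action.

Chords. A closed walk of length at least three and greater than `θ` is not an isometric cycle, so
two of its vertices are joined by a path shorter than both arcs between them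
(`exists_chord_of_lt_length`). Cutting along this path gives shorter closed walks. By induction, an
evaluation of walks in a groupoid that is trivial on closed walks of length at most `max θ 2` is
trivial on all closed walks (`walkHom_eq_id_of_short`). In the fundamental groupoid this says that
discs attached along the short closed walks make the graph simply connected; in the group presented
by short relators it yields finite presentability.

Quotient. There are finitely many orbits of vertices, edges and attached discs, so the quotient of
the filled graph by `G` is a compact 2-complex. The quotient map is a regular covering with group
`G` and simply connected total space, whose 1-skeleton is `Δ`. The topological input is
`Attach.path_induction`, a van Kampen argument that deforms paths into the 1-skeleton and then to
walks. -/

lemma norm_addCircle_le (n : ℕ) (x : ℝ) (k : ℤ) : ‖(x : AddCircle (n : ℝ))‖ ≤ |x + k * n| := by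
  have h : ((x + k * n : ℝ) : AddCircle (n : ℝ)) = x := by
    rw [AddCircle.coe_add, ← zsmul_eq_mul, AddCircle.coe_zsmul, AddCircle.coe_period, smul_zero,
      add_zero]
  rw [← h]
  exact QuotientAddGroup.norm_mk_le_norm

lemma exists_norm_addCircle_eq (n : ℕ) (x : ℝ) :
    ∃ k : ℤ, ‖(x : AddCircle (n : ℝ))‖ = |x + k * n| :=
  ⟨-round ((n : ℝ)⁻¹ * x), by rw [AddCircle.norm_eq]; push_cast; ring_nf⟩

lemma norm_addCircle_natCast {n k : ℕ} (hk : k ≤ n) :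
    ‖((k : ℝ) : AddCircle (n : ℝ))‖ = min (k : ℝ) (n - k) := by
  have hk' : (k : ℝ) ≤ n := by exact_mod_cast hk
  have hk0 : (0 : ℝ) ≤ k := k.cast_nonneg
  apply le_antisymm
  · refine le_min ?_ ?_
    · simpa using norm_addCircle_le n k 0
    · refine (norm_addCircle_le n k (-1)).trans (le_of_eq ?_)
      rw [abs_of_nonpos] <;> push_cast <;> linarith
  · obtain ⟨m, hm⟩ := exists_norm_addCircle_eq n k
    rw [hm]
    rcases le_or_gt 0 m with h | h
    · have : (0 : ℝ) ≤ m * n := by positivity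
      exact (min_le_left _ _).trans ((by linarith : (k : ℝ) ≤ k + m * n).trans (le_abs_self _))
    · have h1 : (m : ℝ) ≤ -1 := by exact_mod_cast (by omega : m ≤ -1)
      have : (m : ℝ) * n ≤ -n := by nlinarith [(n.cast_nonneg : (0 : ℝ) ≤ n)]
      exact (min_le_right _ _).trans ((by linarith : (n - k : ℝ) ≤ -(k + m * n)).trans
        (neg_le_abs _))

variable {V : Type v} {Γ : SimpleGraph V}

/-- The length of a shortest path between two points on edges that runs through an end of each of
the two edges. -/
noncomputable def EdgePoint.detour (p q : EdgePoint Γ) : ℝ :=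
  min (p.distVertex q.dart.fst + q.pos) (p.distVertex q.dart.snd + (1 - q.pos))

/-- Only points of a common edge matter, since otherwise the two sides differ exactly by 2; for a
common edge, going through one shared end costs at most 2. -/
lemma EdgePoint.detour_le_dist_add_two (p q : EdgePoint Γ) : p.detour q ≤ p.dist q + 2 := by
  have hp := p.pos_mem
  have hq := q.pos_mem
  simp only [Set.mem_Icc] at hp hq
  unfold EdgePoint.dist
  split_ifs with h1 h2
  · have : p.detour q ≤ p.pos + (Γ.dist p.dart.fst q.dart.fst : ℝ) + q.pos :=
      (min_le_left _ _).trans (by gcongr; exact min_le_left _ _)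
    rw [h1, SimpleGraph.dist_self] at this
    have := abs_nonneg (p.pos - q.pos)
    push_cast at *
    linarith
  · have : p.detour q ≤ p.pos + (Γ.dist p.dart.fst q.dart.snd : ℝ) + (1 - q.pos) :=
      (min_le_right _ _).trans (by gcongr; exact min_le_left _ _)
    rw [h2] at this
    have h3 : q.dart.symm.fst = q.dart.snd := rfl
    rw [h3, SimpleGraph.dist_self] at this
    have := abs_nonneg (p.pos - (1 - q.pos))
    push_cast at *
    linarith
  · change p.detour q ≤ p.detour q + 2
    linarith

lemma EdgePoint.dist_le_detour (p q : EdgePoint Γ) : p.dist q ≤ p.detour q := by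
  have hp := p.pos_mem
  have hq := q.pos_mem
  simp only [Set.mem_Icc] at hp hq
  unfold EdgePoint.dist
  split_ifs with h1 h2
  · have e1 : Γ.dist q.dart.fst q.dart.snd = 1 := SimpleGraph.dist_eq_one_iff_adj.2 q.dart.adj
    have e2 : Γ.dist q.dart.snd q.dart.fst = 1 := by rw [SimpleGraph.dist_comm, e1]
    simp only [EdgePoint.detour, EdgePoint.distVertex, h1, e1, e2, SimpleGraph.dist_self]
    push_cast
    simp only [le_min_iff, ← min_add_add_right, abs_le]
    refine ⟨⟨⟨?_, ?_⟩, ⟨?_, ?_⟩⟩, ⟨?_, ?_⟩, ⟨?_, ?_⟩⟩ <;> linarith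
  · have e1 : Γ.dist q.dart.fst q.dart.snd = 1 := SimpleGraph.dist_eq_one_iff_adj.2 q.dart.adj
    have e2 : Γ.dist q.dart.snd q.dart.fst = 1 := by rw [SimpleGraph.dist_comm, e1]
    have h3 : q.dart.symm.fst = q.dart.snd := rfl
    have h4 : q.dart.symm.snd = q.dart.fst := rfl
    simp only [EdgePoint.detour, EdgePoint.distVertex, h2, h3, h4, e1, e2, SimpleGraph.dist_self]
    push_cast
    simp only [le_min_iff, ← min_add_add_right, abs_le]
    refine ⟨⟨⟨?_, ?_⟩, ⟨?_, ?_⟩⟩, ⟨?_, ?_⟩, ⟨?_, ?_⟩⟩ <;> linarith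
  · exact le_rfl

variable {n : ℕ}

lemma Cycle.dist_point_intCast (hΓ : Γ.Connected) (f : Cycle Γ n) (i j : ℤ) :
    (f.point i).dist (f.point j) = Γ.dist (f.vert i) (f.vert j) := by
  have hi : f.point i = ⟨⟨(f.vert i, f.vert (i + 1)), f.adj _⟩, 0, by simp⟩ := by
    simp [Cycle.point]
  have hj : f.point j = ⟨⟨(f.vert j, f.vert (j + 1)), f.adj _⟩, 0, by simp⟩ := by
    simp [Cycle.point]
  rw [hi, hj]
  clear hi hj
  generalize_proofs h1 h2 h3
  generalize f.vert i = x at *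
  generalize f.vert (i + 1) = x' at *
  generalize f.vert j = y at *
  generalize f.vert (j + 1) = y' at *
  have t1 : (Γ.dist x y : ℝ) ≤ 1 + Γ.dist x' y := by
    have := hΓ.dist_triangle (u := x) (v := x') (w := y)
    rw [SimpleGraph.dist_eq_one_iff_adj.2 h1] at this
    exact_mod_cast this
  have t2 : (Γ.dist x y : ℝ) ≤ Γ.dist x y' + 1 := by
    have := hΓ.dist_triangle (u := x) (v := y') (w := y)
    rw [SimpleGraph.dist_eq_one_iff_adj.2 h3.symm] at this
    exact_mod_cast this
  have t3 : (Γ.dist x y' : ℝ) ≤ 1 + Γ.dist x' y' := by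
    have := hΓ.dist_triangle (u := x) (v := x') (w := y')
    rw [SimpleGraph.dist_eq_one_iff_adj.2 h1] at this
    exact_mod_cast this
  unfold EdgePoint.dist
  split_ifs with h4 h5
  · simp only [SimpleGraph.Dart.mk.injEq, Prod.mk.injEq] at h4
    simp [h4.1]
  · have h6 : x = y' := congrArg (fun d : Γ.Dart => d.fst) h5
    subst h6
    simp [SimpleGraph.dist_eq_one_iff_adj.2 h3.symm]
  · simp only [EdgePoint.distVertex]
    simp only [zero_add, sub_zero, add_zero]
    rw [min_eq_left t1, min_eq_left t3, min_eq_left t2]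

lemma Cycle.IsIsometric.dist_vert (hΓ : Γ.Connected) {f : Cycle Γ n} (hf : f.IsIsometric)
    (i j : ℤ) : (Γ.dist (f.vert i) (f.vert j) : ℝ) = ‖((i - j : ℝ) : AddCircle (n : ℝ))‖ := by
  rw [← f.dist_point_intCast hΓ, hf, dist_eq_norm]
  rfl

/-- This reduces isometry, a condition on all real points, to the vertices. On both sides the
distance between points of different edges is a minimum over the ends of the edges. -/
lemma Cycle.isIsometric_of_dist_vert (hn : 3 ≤ n) (f : Cycle Γ n)
    (h : ∀ i j : ℤ, (Γ.dist (f.vert i) (f.vert j) : ℝ) = ‖((i - j : ℝ) : AddCircle (n : ℝ))‖) :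
    f.IsIsometric := by
  intro x y
  have hn' : (3 : ℝ) ≤ n := by exact_mod_cast hn
  set i := ⌊x⌋ with hi
  set j := ⌊y⌋ with hj
  have hx : x = i + Int.fract x := (Int.floor_add_fract x).symm
  have hy : y = j + Int.fract y := (Int.floor_add_fract y).symm
  have hx0 := Int.fract_nonneg x
  have hx1 := Int.fract_lt_one x
  have hy0 := Int.fract_nonneg y
  have hy1 := Int.fract_lt_one y
  set s := Int.fract x with hs
  set t := Int.fract y with ht
  have hD : dist (x : AddCircle (n : ℝ)) (y : AddCircle (n : ℝ)) =
      ‖((i - j + (s - t) : ℝ) : AddCircle (n : ℝ))‖ := by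
    rw [dist_eq_norm, ← AddCircle.coe_sub]
    congr 2
    linarith
  have hpx : f.point x = ⟨⟨(f.vert i, f.vert ((i + 1 : ℤ) : ZMod n)), by
      push_cast; exact f.adj _⟩, s, ⟨hx0, hx1.le⟩⟩ := by
    simp [Cycle.point, hi, hs]
  have hpy : f.point y = ⟨⟨(f.vert j, f.vert ((j + 1 : ℤ) : ZMod n)), by
      push_cast; exact f.adj _⟩, t, ⟨hy0, hy1.le⟩⟩ := by
    simp [Cycle.point, hj, ht]
  have vert_inj : ∀ a b : ℤ, f.vert a = f.vert b → ∃ k : ℤ, a - b = k * n := by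
    intro a b hab
    have h0 := h a b
    rw [hab, SimpleGraph.dist_self] at h0
    obtain ⟨k, hk⟩ := exists_norm_addCircle_eq n (a - b : ℝ)
    rw [hk] at h0
    have h1 : (a - b : ℝ) + k * n = 0 := by
      rw [← abs_eq_zero]; simpa using h0.symm
    refine ⟨-k, ?_⟩
    have : ((a - b : ℤ) : ℝ) = ((-k * n : ℤ) : ℝ) := by push_cast; linarith
    exact_mod_cast this
  rw [hD, hpx, hpy]
  unfold EdgePoint.dist
  split_ifs with h1 h2
  · simp only [SimpleGraph.Dart.mk.injEq, Prod.mk.injEq] at h1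
    obtain ⟨k, hk⟩ := vert_inj _ _ h1.1
    have hk' : (i - j : ℝ) = k * n := by exact_mod_cast hk
    change |s - t| = _
    apply le_antisymm
    · obtain ⟨m, hm⟩ := exists_norm_addCircle_eq n (i - j + (s - t) : ℝ)
      rw [hm, hk']
      rcases lt_trichotomy (k + m) 0 with hkm | hkm | hkm
      · have h3 : (k + m : ℝ) ≤ -1 := by exact_mod_cast (by omega : k + m ≤ -1)
        have h4 : (k * n + (s - t) + m * n : ℝ) ≤ -n + (s - t) := by nlinarith
        rw [abs_of_nonpos (by linarith : (k * n + (s - t) + m * n : ℝ) ≤ 0)]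
        exact abs_le.2 ⟨by linarith, by linarith⟩
      · have h3 : (k + m : ℝ) = 0 := by exact_mod_cast hkm
        have : (k * n + (s - t) + m * n : ℝ) = s - t := by linear_combination (n : ℝ) * h3
        rw [this]
      · have h3 : (1 : ℝ) ≤ k + m := by exact_mod_cast (by omega : 1 ≤ k + m)
        have h4 : (n + (s - t) : ℝ) ≤ k * n + (s - t) + m * n := by nlinarith
        refine le_trans ?_ ((h4).trans (le_abs_self _))
        exact abs_le.2 ⟨by linarith, by linarith⟩
    · refine (norm_addCircle_le n _ (-k)).trans (le_of_eq ?_)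
      rw [hk']; push_cast; ring_nf
  · exfalso
    have h3 : f.vert i = f.vert ((j + 1 : ℤ) : ZMod n) := congrArg (fun d : Γ.Dart => d.fst) h2
    have h4 : f.vert ((i + 1 : ℤ) : ZMod n) = f.vert j := congrArg (fun d : Γ.Dart => d.snd) h2
    obtain ⟨k, hk⟩ := vert_inj _ _ h3
    obtain ⟨m, hm⟩ := vert_inj _ _ h4
    -- An edge traversed in both directions would give `n ∣ 2`, which `n ≥ 3` excludes.
    have h5 : (m - k) * (n : ℤ) = 2 := by linarith
    have h6 : (n : ℤ) ∣ 2 := ⟨m - k, by linarith⟩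
    have := Int.le_of_dvd (by norm_num) h6
    omega
  · simp only [EdgePoint.distVertex, h, ← min_add_add_right]
    have key : ∀ a : ℤ, ‖((i - j + (s - t) : ℝ) : AddCircle (n : ℝ))‖ ≤
        ‖(((i - j + a : ℤ) : ℝ) : AddCircle (n : ℝ))‖ + |s - t - a| := by
      intro a
      have e : (i - j + (s - t) : ℝ) = ((i - j + a : ℤ) : ℝ) + (s - t - a) := by push_cast; ring
      rw [e, AddCircle.coe_add]
      refine (norm_add_le _ _).trans ?_
      gcongr
      simpa using norm_addCircle_le n (s - t - a) 0
    apply le_antisymm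
    · obtain ⟨k, hk⟩ := exists_norm_addCircle_eq n (i - j + (s - t) : ℝ)
      rw [hk]
      -- The sign says on which side the shortest arc leaves the edge of `x`, hence which two ends
      -- it passes. The value 0 would mean that the two edges coincide.
      rcases lt_trichotomy (i - j + k * n) 0 with hM | hM | hM
      · refine (min_le_left _ _).trans ((min_le_right _ _).trans ?_)
        have h3 : (i - j + k * n : ℝ) ≤ -1 := by exact_mod_cast (by omega : i - j + k * n ≤ -1)
        have h4 := norm_addCircle_le n (((i + 1 : ℤ) : ℝ) - j) k
        have h5 : (((i + 1 : ℤ) : ℝ) - j + k * n) ≤ 0 := by push_cast; linarith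
        rw [abs_of_nonpos h5] at h4
        rw [abs_of_nonpos (by linarith)]
        push_cast at h4 ⊢
        linarith
      · exfalso
        apply h1
        have h3 : ((i : ℤ) : ZMod n) = j := by
          have : ((i - j + k * n : ℤ) : ZMod n) = 0 := by rw [hM]; simp
          push_cast at this
          rw [ZMod.natCast_self, mul_zero, add_zero] at this
          exact sub_eq_zero.1 this
        simp [h3]
      · refine (min_le_right _ _).trans ((min_le_left _ _).trans ?_)
        have h3 : (1 : ℝ) ≤ (i - j + k * n : ℝ) := by exact_mod_cast (by omega : 1 ≤ i - j + k * n)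
        have h4 := norm_addCircle_le n ((i : ℝ) - ((j + 1 : ℤ) : ℝ)) k
        have h5 : 0 ≤ ((i : ℝ) - ((j + 1 : ℤ) : ℝ)) + k * n := by push_cast; linarith
        rw [abs_of_nonneg h5] at h4
        rw [abs_of_nonneg (by linarith)]
        push_cast at h4 ⊢
        linarith
    · refine le_min (le_min ?_ ?_) (le_min ?_ ?_)
      · have := key 0
        have h3 : |s - t - (0 : ℤ)| ≤ s + t := abs_le.2
            ⟨by push_cast; linarith, by push_cast; linarith⟩
        push_cast at this h3 ⊢
        rw [add_zero] at this
        linarith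
      · have := key 1
        have h3 : |s - t - (1 : ℤ)| ≤ 1 - s + t := abs_le.2
            ⟨by push_cast; linarith, by push_cast; linarith⟩
        have e : (((i + 1 : ℤ) : ℝ) - j : ℝ) = ((i - j + 1 : ℤ) : ℝ) := by push_cast; ring
        rw [e]
        linarith
      · have := key (-1)
        have h3 : |s - t - (-1 : ℤ)| ≤ s + (1 - t) := abs_le.2
            ⟨by push_cast; linarith, by push_cast; linarith⟩
        have e : (i - ((j + 1 : ℤ) : ℝ) : ℝ) = ((i - j + -1 : ℤ) : ℝ) := by push_cast; ring
        rw [e]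
        linarith
      · have := key 0
        have h3 : |s - t - (0 : ℤ)| ≤ 1 - s + (1 - t) := abs_le.2
            ⟨by push_cast; linarith, by push_cast; linarith⟩
        have e : (((i + 1 : ℤ) : ℝ) - ((j + 1 : ℤ) : ℝ) : ℝ) = ((i - j + 0 : ℤ) : ℝ) := by
          push_cast; ring
        rw [e]
        linarith

end CycleMetric

end Shortcut

namespace Shortcut

section Transfer

/-! ### Transferring the shortcut properties -/

variable {V : Type u} {W : Type v} {Γ : SimpleGraph V} {Δ : SimpleGraph W} {n : ℕ}

lemma dist_map_le (hΔ : Δ.Connected) (π : Δ →g Γ) (x y : W) :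
    Γ.dist (π x) (π y) ≤ Δ.dist x y := by
  obtain ⟨w, hw⟩ := hΔ.exists_walk_length_eq_dist x y
  rw [← hw, ← SimpleGraph.Walk.length_map π w]
  exact SimpleGraph.dist_le _

/-- The image of a cycle under a graph homomorphism. -/
def Cycle.map (π : Δ →g Γ) (f : Cycle Δ n) : Cycle Γ n where
  vert i := π (f.vert i)
  adj i := π.map_adj (f.adj i)

/-- Only a distance `K ≤ 3` could shrink. Prolonging the short arc by four edges gives an arc of `K
+ 4 ≤ 7 ≤ n / 2` edges, still geodesic and too long to shrink. Since the four added edges account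
for at most 4 after projection, at least `K` remains for the original pair. -/
lemma dist_le_of_isometric_long (hΓ : Γ.Connected) (hΔ : Δ.Connected) (π : Δ →g Γ)
    (hd : ∀ x y, Δ.dist x y ≤ max (Γ.dist (π x) (π y)) 3) (hn : 14 ≤ n) {f : Cycle Δ n}
    (hf : f.IsIsometric) (i j : ℤ) :
    Δ.dist (f.vert i) (f.vert j) ≤ Γ.dist (π (f.vert i)) (π (f.vert j)) := by
  by_contra! hlt
  have h3 : Δ.dist (f.vert i) (f.vert j) ≤ 3 := by
    have := hd (f.vert i) (f.vert j)
    rw [le_max_iff] at this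
    omega
  obtain ⟨k, hk⟩ := exists_norm_addCircle_eq n (i - j : ℝ)
  rw [← hf.dist_vert hΔ] at hk
  -- The lift `a` of `i` is chosen so that `|a - j|` is the length of the shorter arc; `ε` below is
  -- the direction from `j` to `a`.
  set a : ℤ := i + k * n with ha
  have hai : f.vert (a : ZMod n) = f.vert i := by simp [ha]
  rw [← hai] at hlt h3 hk
  obtain ⟨ε, hε, hK⟩ : ∃ ε : ℤ, |ε| = 1 ∧ ε * (a - j) = Δ.dist (f.vert a) (f.vert j) := by
    have hk' : ((Δ.dist (f.vert a) (f.vert j) : ℤ) : ℝ) = ((|a - j| : ℤ) : ℝ) := by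
      push_cast
      rw [hk, ha]
      push_cast
      ring_nf
    have hk'' := Int.cast_injective hk'
    rcases le_total 0 (a - j) with h | h
    · exact ⟨1, by simp, by rw [hk'', abs_of_nonneg h, one_mul]⟩
    · exact ⟨-1, by simp, by rw [hk'', abs_of_nonpos h]; ring⟩
  set K := Δ.dist (f.vert a) (f.vert j) with hKdef
  have hε2 : ε = 1 ∨ ε = -1 := by
    rcases abs_cases ε with h | h <;> omega
  have hnorm : ∀ m : ℕ, 2 * m ≤ n → ∀ r : ℝ, r = m ∨ r = -m →
      ‖(r : AddCircle (n : ℝ))‖ = m := by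
    intro m hm r hr
    have : ‖((m : ℝ) : AddCircle (n : ℝ))‖ = m := by
      rw [norm_addCircle_natCast (by omega), min_eq_left]
      have : (2 * m : ℝ) ≤ n := by exact_mod_cast hm
      linarith
    rcases hr with rfl | rfl
    · exact this
    · rw [AddCircle.coe_neg, norm_neg, this]
  have h4 : Δ.dist (f.vert ((a + ε * 4 : ℤ) : ZMod n)) (f.vert a) = 4 := by
    have := hf.dist_vert hΔ (a + ε * 4) a
    rw [hnorm 4 (by omega)] at this
    · exact_mod_cast this
    · rcases hε2 with rfl | rfl
      · left; push_cast; ring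
      · right; push_cast; ring
  have hK4 : Δ.dist (f.vert ((a + ε * 4 : ℤ) : ZMod n)) (f.vert j) = K + 4 := by
    have := hf.dist_vert hΔ (a + ε * 4) j
    rw [hnorm (K + 4) (by omega)] at this
    · exact_mod_cast this
    · have hK' : (ε * (a - j) : ℝ) = K := by exact_mod_cast hK
      rcases hε2 with rfl | rfl
      · left; push_cast at *; linarith
      · right; push_cast at *; linarith
  have h5 := dist_map_le hΔ π (f.vert ((a + ε * 4 : ℤ) : ZMod n)) (f.vert a)
  have h6 := hΓ.dist_triangle (u := π (f.vert ((a + ε * 4 : ℤ) : ZMod n))) (v := π (f.vert a))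
    (w := π (f.vert j))
  have h7 := hd (f.vert ((a + ε * 4 : ℤ) : ZMod n)) (f.vert j)
  rw [le_max_iff] at h7
  rw [hai] at *
  omega

/-- Being shortcut lifts along a graph homomorphism that does not decrease large distances. -/
theorem IsShortcutGraph.of_hom (hΓ : IsShortcutGraph Γ) (hΔ : Δ.Connected) (π : Δ →g Γ)
    (hd : ∀ x y, Δ.dist x y ≤ max (Γ.dist (π x) (π y)) 3) : IsShortcutGraph Δ := by
  obtain ⟨hc, θ, hθ⟩ := hΓ
  refine ⟨hΔ, max θ 14, fun n hn f hf => ?_⟩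
  by_contra! hlt
  rw [max_lt_iff] at hlt
  have : (f.map π).IsIsometric := by
    refine Cycle.isIsometric_of_dist_vert (by omega) _ fun i j => ?_
    rw [← hf.dist_vert hΔ]
    exact_mod_cast le_antisymm (dist_map_le hΔ π _ _)
      (dist_le_of_isometric_long hc hΔ π hd (by omega) hf i j)
  have := hθ n hn _ this
  omega

lemma EdgePoint.detour_le_detour_add (p q : EdgePoint Δ) (p' q' : EdgePoint Γ)
    (hp : p.pos = p'.pos) (hq : q.pos = q'.pos) (C : ℝ)
    (h11 : (Δ.dist p.dart.fst q.dart.fst : ℝ) ≤ Γ.dist p'.dart.fst q'.dart.fst + C)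
    (h12 : (Δ.dist p.dart.fst q.dart.snd : ℝ) ≤ Γ.dist p'.dart.fst q'.dart.snd + C)
    (h21 : (Δ.dist p.dart.snd q.dart.fst : ℝ) ≤ Γ.dist p'.dart.snd q'.dart.fst + C)
    (h22 : (Δ.dist p.dart.snd q.dart.snd : ℝ) ≤ Γ.dist p'.dart.snd q'.dart.snd + C) :
    p.detour q ≤ p'.detour q' + C := by
  simp only [EdgePoint.detour, EdgePoint.distVertex, ← min_add_add_right, hp, hq]
  refine le_min (le_min ?_ ?_) (le_min ?_ ?_)
  · exact (min_le_left _ _).trans ((min_le_left _ _).trans (by linarith))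
  · exact (min_le_left _ _).trans ((min_le_right _ _).trans (by linarith))
  · exact (min_le_right _ _).trans ((min_le_left _ _).trans (by linarith))
  · exact (min_le_right _ _).trans ((min_le_right _ _).trans (by linarith))

/-- Being strongly shortcut lifts along a graph homomorphism that does not decrease large
distances. -/
theorem IsStronglyShortcutGraph.of_hom (hΓ : IsStronglyShortcutGraph Γ) (hΔ : Δ.Connected)
    (π : Δ →g Γ) (hd : ∀ x y, Δ.dist x y ≤ max (Γ.dist (π x) (π y)) 3) :
    IsStronglyShortcutGraph Δ := by
  obtain ⟨hc, θ, ξ, h0, h1, hθ⟩ := hΓ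
  -- Projecting costs at most 5: the 3 of `hd` and the 2 of `detour_le_dist_add_two`. Replacing `ξ`
  -- by `(1 + ξ) / 2` gains `(1 - ξ) n / 4`, which exceeds 5 once `n > 20 / (1 - ξ)`.
  refine ⟨hΔ, max θ ⌈20 / (1 - ξ)⌉₊, (1 + ξ) / 2, by linarith, by linarith, fun n hn f hf => ?_⟩
  by_contra! hlt
  rw [max_lt_iff] at hlt
  have hn' : 20 / (1 - ξ) < n := Nat.lt_of_ceil_lt hlt.2
  rw [div_lt_iff₀ (by linarith)] at hn'
  have : (f.map π).IsAlmostIsometric ξ := by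
    intro x
    have h2 := hf x
    have hd' : ∀ x y, (Δ.dist x y : ℝ) ≤ Γ.dist (π x) (π y) + 3 := fun x y => by
      have := hd x y
      rw [le_max_iff] at this
      exact_mod_cast (by omega : Δ.dist x y ≤ Γ.dist (π x) (π y) + 3)
    have h3 := EdgePoint.dist_le_detour (f.point x) (f.point (x + n / 2))
    have h4 := EdgePoint.detour_le_detour_add (f.point x) (f.point (x + n / 2))
      ((f.map π).point x) ((f.map π).point (x + n / 2)) rfl rfl 3
      (hd' _ _) (hd' _ _) (hd' _ _) (hd' _ _)
    have h5 := EdgePoint.detour_le_dist_add_two ((f.map π).point x) ((f.map π).point (x + n / 2))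
    nlinarith
  have := hθ n hn _ this
  omega

/-- Antipodal points of an isometric cycle are at distance exactly `n / 2`, so it is `ξ`-almost
isometric for every `ξ < 1`. -/
theorem IsStronglyShortcutGraph.isShortcutGraph (hΓ : IsStronglyShortcutGraph Γ) :
    IsShortcutGraph Γ := by
  obtain ⟨hc, θ, ξ, h0, h1, hθ⟩ := hΓ
  refine ⟨hc, θ, fun n hn f hf => hθ n hn f fun x => ?_⟩
  have hn' : (0 : ℝ) < n := by exact_mod_cast hn
  have : dist (x : AddCircle (n : ℝ)) ((x + n / 2 : ℝ) : AddCircle (n : ℝ)) = n / 2 := by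
    rw [dist_comm, dist_eq_norm, ← AddCircle.coe_sub, add_sub_cancel_left]
    have := AddCircle.norm_half_period_eq (n : ℝ)
    rwa [abs_of_pos hn'] at this
  rw [hf, this]
  nlinarith

theorem isStronglyShortcutGraph_of_dist_le (hΓ : Γ.Connected) (D : ℕ)
    (hD : ∀ x y, Γ.dist x y ≤ D) : IsStronglyShortcutGraph Γ := by
  -- Any two points of edges are at distance at most `D + 2`, so `n / 4 ≤ D + 2` for a `1 /
  -- 2`-almost isometric cycle.
  refine ⟨hΓ, 4 * (D + 2), 1 / 2, by norm_num, by norm_num, fun n hn f hf => ?_⟩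
  have h1 := hf 0
  set p := f.point 0
  set q := f.point (0 + n / 2)
  have h2 := EdgePoint.dist_le_detour p q
  have h3 : p.detour q ≤ p.pos + (Γ.dist p.dart.fst q.dart.fst : ℝ) + q.pos :=
    (min_le_left _ _).trans (by gcongr; exact min_le_left _ _)
  have h4 : (Γ.dist p.dart.fst q.dart.fst : ℝ) ≤ D := by exact_mod_cast hD _ _
  have h5 := p.pos_mem.2
  have h6 := q.pos_mem.2
  have : (n : ℝ) ≤ 4 * (D + 2) := by linarith
  exact_mod_cast this

end Transfer

section Chords

/-! ### Long closed walks in shortcut graphs have chords -/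

variable {V : Type u} {Γ : SimpleGraph V}

lemma dist_getVert_le (hΓ : Γ.Connected) {u v : V} (w : Γ.Walk u v) {i j : ℕ} (hij : i ≤ j)
    (hj : j ≤ w.length) : Γ.dist (w.getVert i) (w.getVert j) ≤ j - i := by
  induction j, hij using Nat.le_induction with
  | base => simp
  | succ j hij ih =>
    have h1 := ih (by omega)
    have h2 := hΓ.dist_triangle (u := w.getVert i) (v := w.getVert j) (w := w.getVert (j + 1))
    rw [SimpleGraph.dist_eq_one_iff_adj.2 (w.adj_getVert_succ (by omega))] at h2
    omega

lemma exists_eq_append {u v : V} (w : Γ.Walk u v) {k : ℕ} (hk : k ≤ w.length) :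
    ∃ (y : V) (a : Γ.Walk u y) (b : Γ.Walk y v), w = a.append b ∧ a.length = k := by
  induction w generalizing k with
  | nil => exact ⟨_, .nil, .nil, rfl, by simp at hk; simp [hk]⟩
  | cons h w ih =>
    cases k with
    | zero => exact ⟨_, .nil, .cons h w, rfl, rfl⟩
    | succ k =>
      obtain ⟨y, a, b, hw, ha⟩ := ih (k := k) (by simpa using hk)
      exact ⟨y, .cons h a, b, by rw [hw, SimpleGraph.Walk.cons_append], by simp [ha]⟩

lemma exists_eq_append_append {u v : V} (w : Γ.Walk u v) {i j : ℕ} (hij : i ≤ j)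
    (hj : j ≤ w.length) :
    ∃ (y z : V) (a : Γ.Walk u y) (m : Γ.Walk y z) (b : Γ.Walk z v), w = a.append (m.append b) ∧
      a.length = i ∧ m.length = j - i ∧ y = w.getVert i ∧ z = w.getVert j := by
  obtain ⟨y, a, w', rfl, ha⟩ := exists_eq_append w (hij.trans hj)
  obtain ⟨z, m, b, rfl, hm⟩ := exists_eq_append w' (k := j - i) (by simp at hj; omega)
  refine ⟨y, z, a, m, b, rfl, ha, hm, ?_, ?_⟩
  · simp [SimpleGraph.Walk.getVert_append, ha]
  · have : ¬ j < i := by omega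
    simp [SimpleGraph.Walk.getVert_append, ha, hm, this]

/-- The cycle traced by a closed walk. -/
def Cycle.ofWalk {u : V} (w : Γ.Walk u u) (h : 2 ≤ w.length) : Cycle Γ w.length where
  vert i := w.getVert i.val
  adj i := by
    have : NeZero w.length := ⟨by omega⟩
    have : Fact (1 < w.length) := ⟨by omega⟩
    have hi := i.val_lt
    rw [ZMod.val_add, ZMod.val_one]
    rcases Nat.lt_or_ge (i.val + 1) w.length with h1 | h1
    · rw [Nat.mod_eq_of_lt h1]
      exact w.adj_getVert_succ hi
    · have h2 : i.val + 1 = w.length := by omega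
      have h3 := w.adj_getVert_succ hi
      rw [h2, w.getVert_length] at h3
      rw [h2, Nat.mod_self, w.getVert_zero]
      exact h3

/-- Without such a chord, every distance between vertices of the walk would be the length of the
shorter arc, and the walk would trace an isometric cycle longer than `θ`. -/
theorem exists_chord_of_lt_length (hΓ : Γ.Connected) {θ : ℕ}
    (hθ : ∀ n : ℕ, 1 ≤ n → ∀ f : Cycle Γ n, f.IsIsometric → n ≤ θ) {u : V} (w : Γ.Walk u u)
    (hw : θ < w.length) (h3 : 3 ≤ w.length) :
    ∃ i j : ℕ, i ≤ j ∧ j ≤ w.length ∧ Γ.dist (w.getVert i) (w.getVert j) < j - i ∧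
      Γ.dist (w.getVert i) (w.getVert j) + (j - i) < w.length := by
  by_contra! hcon
  have : NeZero w.length := ⟨by omega⟩
  refine absurd (hθ _ (by omega) (Cycle.ofWalk w (by omega)) ?_) (by omega)
  have key : ∀ a b : ℕ, a ≤ b → b ≤ w.length →
      (Γ.dist (w.getVert a) (w.getVert b) : ℝ) =
        ‖((a - b : ℝ) : AddCircle (w.length : ℝ))‖ := by
    intro a b hab hb
    have e : (a - b : ℝ) = -((b - a : ℕ) : ℝ) := by rw [Nat.cast_sub hab]; ring
    rw [e, AddCircle.coe_neg, norm_neg, norm_addCircle_natCast (by omega),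
      ← Nat.cast_sub (by omega), ← Nat.cast_min, Nat.cast_inj]
    apply le_antisymm
    · refine le_min (dist_getVert_le hΓ w hab hb) ?_
      have h1 := dist_getVert_le hΓ w (Nat.zero_le a) (by omega)
      have h2 := dist_getVert_le hΓ w hb le_rfl
      have h4 := hΓ.dist_triangle (u := w.getVert a) (v := u) (w := w.getVert b)
      rw [w.getVert_zero] at h1
      rw [w.getVert_length] at h2
      rw [SimpleGraph.dist_comm] at h1 h2
      omega
    · have := hcon a b hab hb
      rw [min_le_iff]
      omega
  refine Cycle.isIsometric_of_dist_vert h3 _ fun i j => ?_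
  -- The walk is indexed by residues in `[0, n)`, so arbitrary integers are first reduced modulo
  -- `n`.
  have red : ((i - j : ℝ) : AddCircle (w.length : ℝ)) =
      ((((i : ZMod w.length).val - (j : ZMod w.length).val : ℝ)) : AddCircle (w.length : ℝ)) := by
    have h : ∀ k : ℤ, ((k : ℝ) : AddCircle (w.length : ℝ)) = ((k : ZMod w.length).val : ℝ) := by
      intro k
      have h1 : (((k : ZMod w.length).val : ℕ) : ℤ) = k % w.length := ZMod.val_intCast k
      have h2 : (k : ℝ) = ((k : ZMod w.length).val : ℝ) + (k / w.length : ℤ) * w.length := by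
        have := Int.emod_add_mul_ediv k w.length
        rw [← h1] at this
        calc (k : ℝ) = (((((k : ZMod w.length).val : ℕ) : ℤ) + w.length * (k / w.length) : ℤ) :
          ℝ) := by
              rw [this]
          _ = _ := by push_cast; ring
      conv_lhs => rw [h2]
      rw [AddCircle.coe_add, ← zsmul_eq_mul, AddCircle.coe_zsmul, AddCircle.coe_period, smul_zero,
        add_zero]
    rw [AddCircle.coe_sub, AddCircle.coe_sub, h, h]
  rw [red]
  change (Γ.dist (w.getVert _) (w.getVert _) : ℝ) = _
  rcases le_total (i : ZMod w.length).val (j : ZMod w.length).val with h | h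
  · exact key _ _ h (ZMod.val_lt _).le
  · rw [SimpleGraph.dist_comm, key _ _ h (ZMod.val_lt _).le, ← norm_neg, ← AddCircle.coe_neg,
      neg_sub]

end Chords

section WalkGroupoid

/-! ### Evaluating walks in a groupoid -/

open CategoryTheory

variable {V : Type u} {Γ : SimpleGraph V} {C : Type*} [Category C] (obj : V → C)
  (step : ∀ {x y : V}, Γ.Adj x y → (obj x ⟶ obj y))

/-- The morphism obtained by composing the morphisms assigned to the edges of a walk. -/
def walkHom : ∀ {x y : V}, Γ.Walk x y → (obj x ⟶ obj y)
  | _, _, .nil => 𝟙 _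
  | _, _, .cons h w => step h ≫ walkHom w

lemma walkHom_append {x y z : V} (w : Γ.Walk x y) (w' : Γ.Walk y z) :
    walkHom obj step (w.append w') = walkHom obj step w ≫ walkHom obj step w' := by
  induction w with
  | nil => simp [walkHom]
  | cons h w ih => simp [walkHom, ih]

end WalkGroupoid

/-! ### Reduction of closed walks to short ones. -/

section ClosedWalks

open CategoryTheory

variable {V : Type u} {Γ : SimpleGraph V} {C : Type*} [Groupoid C] (obj : V → C)
  (step : ∀ {x y : V}, Γ.Adj x y → (obj x ⟶ obj y))

/-- In a shortcut graph, closed walks are products of conjugates of short closed walks. -/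
theorem walkHom_eq_id_of_short (hΓ : Γ.Connected) {θ N : ℕ}
    (hθ : ∀ n : ℕ, 1 ≤ n → ∀ f : Cycle Γ n, f.IsIsometric → n ≤ θ) (hN : θ ≤ N) (hN2 : 2 ≤ N)
    (hshort : ∀ (x : V) (w : Γ.Walk x x), w.length ≤ N → walkHom obj step w = 𝟙 _)
    {x : V} (w : Γ.Walk x x) : walkHom obj step w = 𝟙 _ := by
  induction hn : w.length using Nat.strong_induction_on generalizing x with
  | _ n ih =>
    subst hn
    rcases Nat.lt_or_ge N w.length with hlt | hle
    swap
    · exact hshort x w hle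
    obtain ⟨i, j, hij, hj, h1, h2⟩ := exists_chord_of_lt_length hΓ hθ w (by omega) (by omega)
    obtain ⟨y, z, a, m, b, hw, hla, hlm, hy, hz⟩ := exists_eq_append_append w hij hj
    rw [← hy, ← hz] at h1 h2
    have hlb := congrArg SimpleGraph.Walk.length hw
    simp only [SimpleGraph.Walk.length_append] at hlb
    obtain ⟨c, hc⟩ := hΓ.exists_walk_length_eq_dist y z
    -- The chord inequalities make all three walks shorter than `w`. The third is needed because
    -- `step` is not assumed to send reversed edges to inverses: comparing it with the first
    -- identifies `m` with `c`.
    have e1 := ih _ (by simp; omega) (m.append c.reverse) rfl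
    have e2 := ih _ (by simp; omega) (a.append (c.append b)) rfl
    have e3 := ih _ (by simp; omega) (c.append c.reverse) rfl
    rw [hw]
    rw [walkHom_append] at e1 e3
    simp only [walkHom_append] at e2 ⊢
    have : walkHom obj step m = walkHom obj step c := by
      have h4 := e1.trans e3.symm
      have h5 : IsIso (walkHom obj step c.reverse) := inferInstance
      exact (cancel_mono _).1 h4
    rw [this, e2]

end ClosedWalks

end Shortcut

namespace Shortcut

section EquivariantGraphs

/-! ### Cocompact free actions on graphs -/

/-- The free `G`-set with set of orbits `T`. -/
@[ext]
structure FreeSet (G : Type u) (T : Type v) where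
  elt : G
  orb : T

variable {G : Type u} [Group G] {T : Type u}

instance : MulAction G (FreeSet G T) where
  smul k x := ⟨k * x.elt, x.orb⟩
  one_smul _ := FreeSet.ext (one_mul _) rfl
  mul_smul _ _ _ := FreeSet.ext (mul_assoc _ _ _) rfl

@[simp] lemma FreeSet.smul_elt (k : G) (x : FreeSet G T) : (k • x).elt = k * x.elt := rfl
@[simp] lemma FreeSet.smul_orb (k : G) (x : FreeSet G T) : (k • x).orb = x.orb := rfl
@[simp] lemma FreeSet.smul_mk (k g : G) (t : T) :
    k • (⟨g, t⟩ : FreeSet G T) = ⟨k * g, t⟩ := rfl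

lemma FreeSet.inv_elt_smul (x : FreeSet G T) : x.elt⁻¹ • x = ⟨1, x.orb⟩ :=
  FreeSet.ext (inv_mul_cancel _) rfl

/-- A graph with a free action of `G` whose orbits of edges are finite in number and whose vertex
orbits are properly coloured. -/
structure IsEquivariantGraph (Δ : SimpleGraph (FreeSet G T)) (color : T → Fin 3) : Prop where
  smul_adj : ∀ (k : G) {x y : FreeSet G T}, Δ.Adj x y → Δ.Adj (k • x) (k • y)
  finite_adj : ∀ t t' : T, {h : G | Δ.Adj ⟨1, t⟩ ⟨h, t'⟩}.Finite
  color_ne : ∀ {x y : FreeSet G T}, Δ.Adj x y → color x.orb ≠ color y.orb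

variable {Δ : SimpleGraph (FreeSet G T)} {color : T → Fin 3}

/-- The action of a group element as a graph endomorphism. -/
def IsEquivariantGraph.smulHom (hΔ : IsEquivariantGraph Δ color) (k : G) : Δ →g Δ where
  toFun x := k • x
  map_rel' h := hΔ.smul_adj k h

lemma IsEquivariantGraph.finite_neighborSet [Finite T] (hΔ : IsEquivariantGraph Δ color)
    (x : FreeSet G T) : (Δ.neighborSet x).Finite := by
  have hfin : (⋃ t' : T, (fun h : G => (⟨x.elt * h, t'⟩ : FreeSet G T)) ''
      {h : G | Δ.Adj ⟨1, x.orb⟩ ⟨h, t'⟩}).Finite :=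
    Set.finite_iUnion fun t' => (hΔ.finite_adj x.orb t').image _
  refine hfin.subset fun y hy => Set.mem_iUnion.2 ⟨y.orb, x.elt⁻¹ * y.elt, ?_, ?_⟩
  · have := hΔ.smul_adj x.elt⁻¹ hy
    rw [FreeSet.inv_elt_smul] at this
    exact this
  · exact FreeSet.ext (mul_inv_cancel_left _ _) rfl

/-- The closed walks of bounded length based in a fundamental domain. -/
structure BasedLoop (Δ : SimpleGraph (FreeSet G T)) (N : ℕ) where
  base : FreeSet G T
  walk : Δ.Walk base base
  elt_base : base.elt = 1
  length_le : walk.length ≤ N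

lemma IsEquivariantGraph.finite_basedLoop [Finite T] (hΔ : IsEquivariantGraph Δ color) (N : ℕ) :
    Finite (BasedLoop Δ N) := by
  classical
  have : ∀ x, Fintype (Δ.neighborSet x) := fun x => (hΔ.finite_neighborSet x).fintype
  let F : (Σ t : T, {w : Δ.Walk ⟨1, t⟩ ⟨1, t⟩ // w.length < N + 1}) →
      BasedLoop Δ N := fun p => ⟨⟨1, p.1⟩, p.2.1, rfl, Nat.lt_succ_iff.1 p.2.2⟩
  have (t : T) : Finite {w : Δ.Walk ⟨1, t⟩ ⟨1, t⟩ // w.length < N + 1} :=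
    @Finite.of_fintype _ (Δ.fintypeSubtypeWalkLengthLT _ _ _)
  refine Finite.of_surjective F ?_
  rintro ⟨⟨g, t⟩, w, h1, h2⟩
  obtain rfl : g = 1 := h1
  exact ⟨⟨t, w, Nat.lt_succ_iff.2 h2⟩, rfl⟩

/-- The group elements moving a fundamental domain to an adjacent one. -/
@[ext]
structure EdgeElement (Δ : SimpleGraph (FreeSet G T)) where
  val : G
  exists_adj : ∃ t t' : T, Δ.Adj ⟨1, t⟩ ⟨val, t'⟩

lemma IsEquivariantGraph.finite_edgeElement [Finite T] (hΔ : IsEquivariantGraph Δ color) :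
    Finite (EdgeElement Δ) := by
  have : {h : G | ∃ t t' : T, Δ.Adj ⟨1, t⟩ ⟨h, t'⟩}.Finite := by
    have := Set.finite_iUnion fun t => Set.finite_iUnion fun t' => hΔ.finite_adj t t'
    refine this.subset ?_
    rintro h ⟨t, t', ht⟩
    exact Set.mem_iUnion.2 ⟨t, Set.mem_iUnion.2 ⟨t', ht⟩⟩
  have := this.to_subtype
  refine Finite.of_injective (β := {h : G | ∃ t t' : T, Δ.Adj ⟨1, t⟩ ⟨h, t'⟩})
    (fun e : EdgeElement Δ => ⟨e.val, e.exists_adj⟩) fun e f h => EdgeElement.ext ?_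
  exact congrArg Subtype.val h

/-- The group element by which an edge moves. -/
def IsEquivariantGraph.edgeElement (hΔ : IsEquivariantGraph Δ color) {x y : FreeSet G T}
    (h : Δ.Adj x y) : EdgeElement Δ :=
  ⟨x.elt⁻¹ * y.elt, x.orb, y.orb, by
    have := hΔ.smul_adj x.elt⁻¹ h
    rw [FreeSet.inv_elt_smul] at this
    exact this⟩

/-- The sequence of group elements by which the edges of a walk move. -/
def IsEquivariantGraph.word (hΔ : IsEquivariantGraph Δ color) :
    ∀ {x y : FreeSet G T}, Δ.Walk x y → List (EdgeElement Δ)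
  | _, _, .nil => []
  | _, _, .cons h w => hΔ.edgeElement h :: hΔ.word w

lemma IsEquivariantGraph.length_word (hΔ : IsEquivariantGraph Δ color) {x y : FreeSet G T}
    (w : Δ.Walk x y) : (hΔ.word w).length = w.length := by
  induction w with
  | nil => rfl
  | cons h w ih => simp [word, ih]

lemma IsEquivariantGraph.mul_prod_word (hΔ : IsEquivariantGraph Δ color) {x y : FreeSet G T}
    (w : Δ.Walk x y) : x.elt * ((hΔ.word w).map EdgeElement.val).prod = y.elt := by
  induction w with
  | nil => simp [word]
  | cons h w ih =>
    rw [word, List.map_cons, List.prod_cons, ← mul_assoc, ← ih]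
    simp [edgeElement]

lemma IsEquivariantGraph.word_append (hΔ : IsEquivariantGraph Δ color) {x y z : FreeSet G T}
    (w : Δ.Walk x y) (w' : Δ.Walk y z) : hΔ.word (w.append w') = hΔ.word w ++ hΔ.word w' := by
  induction w with
  | nil => rfl
  | cons h w ih => simp [word, ih]

/-- The words of bounded length that represent the identity. -/
def shortRelators (Δ : SimpleGraph (FreeSet G T)) (N : ℕ) : Set (FreeGroup (EdgeElement Δ)) :=
  (fun l : List (EdgeElement Δ) => (l.map FreeGroup.of).prod) ''
    {l | l.length ≤ N ∧ (l.map EdgeElement.val).prod = 1}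

lemma prod_of_eq_one {N : ℕ} {l : List (EdgeElement Δ)} (hl : l.length ≤ N)
    (h1 : (l.map EdgeElement.val).prod = 1) :
    (l.map (PresentedGroup.of (rels := shortRelators Δ N))).prod = 1 := by
  have : (l.map (PresentedGroup.of (rels := shortRelators Δ N))).prod =
      PresentedGroup.mk _ ((l.map FreeGroup.of).prod) := by
    rw [map_list_prod, List.map_map]; rfl
  rw [this]
  exact PresentedGroup.one_of_mem ⟨l, ⟨hl, h1⟩, rfl⟩

/-- Positive words suffice: reversing an edge shows that `h⁻¹` is again a generator, and the
two-letter word `h⁻¹ h` is a relator because `2 ≤ N`. -/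
lemma IsEquivariantGraph.exists_prod_of (hΔ : IsEquivariantGraph Δ color) {N : ℕ} (hN : 2 ≤ N)
    (p : PresentedGroup (shortRelators Δ N)) :
    ∃ l : List (EdgeElement Δ), (l.map PresentedGroup.of).prod = p := by
  obtain ⟨z, rfl⟩ := PresentedGroup.mk_surjective _ p
  induction z using FreeGroup.induction_on with
  | C1 => exact ⟨[], by simp⟩
  | of x => exact ⟨[x], by simp; rfl⟩
  | inv_of x _ =>
    obtain ⟨h, t, t', ha⟩ := x
    have ha' : Δ.Adj ⟨1, t'⟩ ⟨h⁻¹, t⟩ := by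
      simpa using (hΔ.smul_adj h⁻¹ ha).symm
    refine ⟨[⟨h⁻¹, t', t, ha'⟩], ?_⟩
    rw [map_inv, eq_inv_iff_mul_eq_one]
    have := prod_of_eq_one (Δ := Δ) (N := N) (l := [⟨h⁻¹, t', t, ha'⟩, ⟨h, t, t', ha⟩])
      (by simpa using hN) (by simp)
    simpa [PresentedGroup.of] using this
  | mul x y hx hy =>
    obtain ⟨l, hl⟩ := hx
    obtain ⟨m, hm⟩ := hy
    exact ⟨l ++ m, by simp [hl, hm]⟩

open CategoryTheory in
/-- A group with a free cocompact action on a shortcut graph is finitely presented. -/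
theorem IsEquivariantGraph.isFinitelyPresented [Finite T] (hΔ : IsEquivariantGraph Δ color)
    (hs : IsShortcutGraph Δ) : Group.IsFinitelyPresented G := by
  obtain ⟨hc, θ, hθ⟩ := hs
  obtain ⟨⟨_, t₀⟩⟩ := hc.nonempty
  let τ : ∀ s : T, Δ.Walk ⟨1, t₀⟩ ⟨1, s⟩ := fun s => (hc.preconnected _ _).some
  obtain ⟨K, hK⟩ : ∃ K, ∀ s, (τ s).length ≤ K := by
    obtain ⟨K, hK⟩ := (Set.finite_range fun s => (τ s).length).bddAbove
    exact ⟨K, fun s => hK ⟨s, rfl⟩⟩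
  -- `N` must bound `θ` for the cutting argument, 2 for inverses, and `K` so that the words of the
  -- tethers `τ s` are relators.
  set N := max (max θ 2) K with hN
  have := hΔ.finite_edgeElement
  have : Finite (shortRelators Δ N) :=
    (((List.finite_length_le _ N).subset fun l hl => hl.1).image _).to_subtype
  let ev : ∀ {x y : FreeSet G T}, Δ.Walk x y → PresentedGroup (shortRelators Δ N) :=
    fun w => ((hΔ.word w).map PresentedGroup.of).prod
  have ev_short : ∀ {x y : FreeSet G T} (w : Δ.Walk x y), x.elt = y.elt → w.length ≤ N →
      ev w = 1 := by
    intro x y w hxy hw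
    refine prod_of_eq_one (by rwa [hΔ.length_word]) ?_
    have := hΔ.mul_prod_word w
    rw [← hxy] at this
    exact mul_eq_left.1 this
  have ev_closed : ∀ {x : FreeSet G T} (w : Δ.Walk x x), ev w = 1 := by
    -- Composition in a one-object category multiplies in the reverse order, hence the opposite
    -- group.
    let obj : FreeSet G T → SingleObj (PresentedGroup (shortRelators Δ N))ᵐᵒᵖ :=
      fun _ => SingleObj.star _
    let step : ∀ {x y : FreeSet G T}, Δ.Adj x y → (obj x ⟶ obj y) :=
      fun h => MulOpposite.op (PresentedGroup.of (hΔ.edgeElement h))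
    have hev : ∀ {x y : FreeSet G T} (w : Δ.Walk x y),
        walkHom obj step w = MulOpposite.op (ev w) := by
      intro x y w
      induction w with
      | nil => rfl
      | cons h w ih =>
        change step h ≫ walkHom obj step w = _
        rw [ih, SingleObj.comp_as_mul]
        simp only [ev, word, List.map_cons, List.prod_cons, MulOpposite.op_mul]
        rfl
    intro x w
    have := walkHom_eq_id_of_short obj step hc hθ (N := N) (by omega) (by omega)
      (fun x w hw => by rw [hev, ev_short w rfl hw]; rfl) w
    rw [hev] at this
    exact MulOpposite.op_injective this
  have ev_append : ∀ {x y z : FreeSet G T} (w : Δ.Walk x y) (w' : Δ.Walk y z),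
      ev (w.append w') = ev w * ev w' := by
    intro x y z w w'
    simp [ev, hΔ.word_append]
  have tether : ∀ (g : G) (s : T), ∃ w : Δ.Walk ⟨g, t₀⟩ ⟨g, s⟩, w.length ≤ N := by
    intro g s
    refine ⟨((τ s).map (hΔ.smulHom g)).copy (FreeSet.ext (mul_one g) rfl)
      (FreeSet.ext (mul_one g) rfl), ?_⟩
    simpa only [SimpleGraph.Walk.length_copy, SimpleGraph.Walk.length_map] using
      (hK s).trans (le_max_right (max θ 2) K)
  have lift : ∀ (l : List (EdgeElement Δ)) (g k : G), g * (l.map EdgeElement.val).prod = k →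
      ∃ w : Δ.Walk ⟨g, t₀⟩ ⟨k, t₀⟩, ev w = (l.map PresentedGroup.of).prod := by
    intro l
    induction l with
    | nil =>
      rintro g k hk
      obtain rfl : g = k := by simpa using hk
      exact ⟨.nil, by simp [ev, word]⟩
    | cons a l ih =>
      intro g k hk
      obtain ⟨h, s, s', ha⟩ := a
      obtain ⟨w₁, h₁⟩ := tether g s
      obtain ⟨w₃, h₃⟩ := tether (g * h) s'
      obtain ⟨w₄, h₄⟩ := ih (g * h) k (by simpa [mul_assoc] using hk)
      have hadj : Δ.Adj ⟨g, s⟩ ⟨g * h, s'⟩ := by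
        have := hΔ.smul_adj g ha
        simpa using this
      -- A generator only gives an edge between some vertices of two translates of the fundamental
      -- domain. The tethers connect its ends to the base vertices and evaluate to 1, since each
      -- stays over one group element at its ends and is short.
      refine ⟨w₁.append (.cons hadj (w₃.reverse.append w₄)), ?_⟩
      have e5 : ∀ {z : FreeSet G T} (w' : Δ.Walk _ z), ev (.cons hadj w') =
          PresentedGroup.of (⟨h, s, s', ha⟩ : EdgeElement Δ) * ev w' := by
        intro z w'
        have : hΔ.edgeElement hadj = ⟨h, s, s', ha⟩ := EdgeElement.ext (inv_mul_cancel_left _ _)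
        simp [ev, word, this]
      rw [ev_append, e5, ev_append, ev_short w₁ rfl h₁, ev_short w₃.reverse rfl (by simpa using h₃),
        h₄]
      simp
  let F : PresentedGroup (shortRelators Δ N) →* G :=
    PresentedGroup.toGroup (f := (EdgeElement.val : EdgeElement Δ → G)) (by
      rintro _ ⟨l, ⟨-, h1⟩, rfl⟩
      simp only [map_list_prod, List.map_map]
      rw [← h1]
      congr 2
      ext x
      simp)
  have hF : ∀ l : List (EdgeElement Δ), F ((l.map PresentedGroup.of).prod) =
      (l.map EdgeElement.val).prod := by
    intro l
    rw [map_list_prod, List.map_map]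
    congr 2
    ext x
    simp [F]
  have hbij : Function.Bijective F := by
    constructor
    · rw [injective_iff_map_eq_one]
      intro p hp
      obtain ⟨l, rfl⟩ := hΔ.exists_prod_of (by omega) p
      rw [hF] at hp
      -- A word that is trivial in `G` lifts to a closed walk, whose evaluation is trivial by
      -- `ev_closed`.
      obtain ⟨w, hw⟩ := lift l 1 1 (by rw [hp, mul_one])
      rw [← hw, ev_closed]
    · intro g
      obtain ⟨w⟩ := hc.preconnected (⟨1, t₀⟩ : FreeSet G T) ⟨g, t₀⟩
      refine ⟨ev w, ?_⟩
      rw [hF]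
      have := hΔ.mul_prod_word w
      simpa using this
  exact Group.IsFinitelyPresented.equiv (MulEquiv.ofBijective F hbij)

end EquivariantGraphs

end Shortcut

namespace Shortcut

section BlowUp

/-! ### Making an action free by blowing up vertices -/

variable {G : Type u} [Group G] {V : Type u} {Γ : SimpleGraph V}

/-- The projection of the blow-up of a graph to the graph. -/
def blowUpProj (φ : G →* (Γ ≃g Γ)) (S : Finset V) (x : FreeSet G (S × Fin 3)) : V :=
  φ x.elt x.orb.1

/-- The blow-up of a graph: every vertex is replaced by a finite set of coloured vertices, and
vertices of different colours are adjacent when their projections are. -/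
def blowUp (φ : G →* (Γ ≃g Γ)) (S : Finset V) : SimpleGraph (FreeSet G (S × Fin 3)) where
  Adj x y := x.orb.2 ≠ y.orb.2 ∧ Γ.Adj (blowUpProj φ S x) (blowUpProj φ S y)
  symm := ⟨fun _ _ h => ⟨h.1.symm, h.2.symm⟩⟩
  loopless := ⟨fun _ h => h.1 rfl⟩

/-- The projection of the blow-up of a graph as a graph homomorphism. -/
def blowUpHom (φ : G →* (Γ ≃g Γ)) (S : Finset V) : blowUp φ S →g Γ where
  toFun := blowUpProj φ S
  map_rel' h := h.2

variable (φ : G →* (Γ ≃g Γ)) {S : Finset V}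

lemma isEquivariantGraph_blowUp (hφ : IsProperAction φ)
    (hS : ∀ u v, Γ.Adj u v → ∃ g, φ g u ∈ S ∧ φ g v ∈ S) :
    IsEquivariantGraph (blowUp φ S) Prod.snd where
  smul_adj k x y h := by
    refine ⟨h.1, ?_⟩
    have := (φ k).map_adj_iff.2 h.2
    simpa [blowUpProj] using this
  finite_adj t t' := by
    have hF := hφ S
    set F := {g : G | ∃ v ∈ S, φ g v ∈ S}
    -- An edge from `t` to `h t'` is moved into `S` by some `g`. Then `g` and `g h` both lie in the
    -- finite set `F`, so `h ∈ F⁻¹ F`.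
    refine (hF.image2 (fun a b => a⁻¹ * b) hF).subset ?_
    rintro h ⟨-, ha⟩
    obtain ⟨g, h1, h2⟩ := hS _ _ ha
    refine ⟨g, ⟨t.1, t.1.2, ?_⟩, g * h, ⟨t'.1, t'.1.2, ?_⟩, inv_mul_cancel_left g h⟩
    · simpa [blowUpProj] using h1
    · simpa [blowUpProj] using h2
  color_ne h := h.1

lemma exists_blowUpProj_eq (hS : ∀ v, ∃ g, φ g v ∈ S) (v : V) (c : Fin 3) :
    ∃ x : FreeSet G (S × Fin 3), blowUpProj φ S x = v ∧ x.orb.2 = c := by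
  obtain ⟨g, hg⟩ := hS v
  refine ⟨⟨g⁻¹, ⟨⟨_, hg⟩, c⟩⟩, ?_, rfl⟩
  simp [blowUpProj]

/-- Colours are chosen greedily, each different from the preceding one. The last intermediate vertex
must avoid the colours of both neighbours, which is why three colours are used. A walk of length one
need not lift, as its prescribed ends may have the same colour. -/
lemma exists_walk_blowUp (hS : ∀ v, ∃ g, φ g v ∈ S) {u v : V} (w : Γ.Walk u v)
    (hw : 2 ≤ w.length) {x y : FreeSet G (S × Fin 3)} (hx : blowUpProj φ S x = u)
    (hy : blowUpProj φ S y = v) : ∃ w' : (blowUp φ S).Walk x y, w'.length = w.length := by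
  induction w generalizing x with
  | nil => simp at hw
  | @cons u a v h w ih =>
    cases w with
    | nil => simp at hw
    | @cons _ b _ h' w =>
      cases w with
      | nil =>
        obtain ⟨c, hc, hc'⟩ : ∃ c : Fin 3, x.orb.2 ≠ c ∧ c ≠ y.orb.2 := by
          generalize x.orb.2 = i
          generalize y.orb.2 = j
          revert i j
          decide
        obtain ⟨z, hz, hzc⟩ := exists_blowUpProj_eq φ hS a c
        have h1 : (blowUp φ S).Adj x z := ⟨hzc ▸ hc, by rwa [hx, hz]⟩
        have h2 : (blowUp φ S).Adj z y := ⟨hzc ▸ hc', by rwa [hz, hy]⟩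
        exact ⟨.cons h1 (.cons h2 .nil), by simp⟩
      | @cons _ d _ h'' w =>
        obtain ⟨c, hc⟩ := exists_ne x.orb.2
        obtain ⟨z, hz, hzc⟩ := exists_blowUpProj_eq φ hS a c
        obtain ⟨w', hw'⟩ := ih (by simp) hz hy
        have h1 : (blowUp φ S).Adj x z := ⟨hzc ▸ hc.symm, by rwa [hx, hz]⟩
        exact ⟨.cons h1 w', by simp [hw']⟩

/-- Walks too short to lift are lengthened: a trivial one by going to a neighbour and back, an edge
by traversing it three times. This is the source of the constant 3. -/
lemma exists_walk_blowUp_length_le (hΓ : Γ.Connected) (hS : ∀ v, ∃ g, φ g v ∈ S)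
    (hnt : Nontrivial V) (x y : FreeSet G (S × Fin 3)) :
    ∃ w : (blowUp φ S).Walk x y,
      w.length ≤ max (Γ.dist (blowUpProj φ S x) (blowUpProj φ S y)) 3 := by
  obtain ⟨w, hw⟩ := hΓ.exists_walk_length_eq_dist (blowUpProj φ S x) (blowUpProj φ S y)
  rw [← hw]
  generalize hu : blowUpProj φ S x = u at *
  generalize hv : blowUpProj φ S y = v at *
  cases w with
  | nil =>
    obtain ⟨v, hv'⟩ := hΓ.preconnected.exists_adj_of_nontrivial u
    obtain ⟨w', hw'⟩ := exists_walk_blowUp φ hS (.cons hv' (.cons hv'.symm .nil)) (by simp) hu hv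
    exact ⟨w', by simp [hw']⟩
  | cons h w =>
    cases w with
    | nil =>
      obtain ⟨w', hw'⟩ := exists_walk_blowUp φ hS (.cons h (.cons h.symm (.cons h .nil)))
        (by simp) hu hv
      exact ⟨w', by simp [hw']⟩
    | cons h' w =>
      obtain ⟨w', hw'⟩ := exists_walk_blowUp φ hS (.cons h (.cons h' w)) (by simp) hu hv
      exact ⟨w', by rw [hw']; exact le_max_left _ _⟩

lemma connected_blowUp (hΓ : Γ.Connected) (hS : ∀ v, ∃ g, φ g v ∈ S) (hnt : Nontrivial V) :
    (blowUp φ S).Connected := by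
  obtain ⟨v⟩ := hΓ.nonempty
  obtain ⟨x, -⟩ := exists_blowUpProj_eq φ hS v 0
  have : Nonempty (FreeSet G (S × Fin 3)) := ⟨x⟩
  exact ⟨fun x y => ⟨(exists_walk_blowUp_length_le φ hΓ hS hnt x y).choose⟩⟩

lemma dist_blowUp_le (hΓ : Γ.Connected) (hS : ∀ v, ∃ g, φ g v ∈ S) (hnt : Nontrivial V)
    (x y : FreeSet G (S × Fin 3)) :
    (blowUp φ S).dist x y ≤ max (Γ.dist (blowUpHom φ S x) (blowUpHom φ S y)) 3 := by
  obtain ⟨w, hw⟩ := exists_walk_blowUp_length_le φ hΓ hS hnt x y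
  exact (SimpleGraph.dist_le w).trans hw

end BlowUp

/-! ### Passage from proper cocompact actions to free ones. -/

section FreeActions

variable {G : Type u} [Group G]

/-- A finite group acts properly and cocompactly on a nontrivial strongly shortcut graph. -/
lemma exists_nontrivial_of_finite [Finite G] :
    ∃ (V : Type u) (Γ : SimpleGraph V) (φ : G →* (Γ ≃g Γ)), Nontrivial V ∧
      IsStronglyShortcutGraph Γ ∧ IsProperAction φ ∧ IsCocompactAction φ := by
  have hc : (⊤ : SimpleGraph (ULift.{u} Bool)).Connected := SimpleGraph.connected_top
  refine ⟨ULift Bool, ⊤, 1, inferInstance, ?_, fun S => Set.toFinite _, Finset.univ, ?_⟩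
  · refine isStronglyShortcutGraph_of_dist_le hc 1 fun x y => ?_
    rcases eq_or_ne x y with rfl | h
    · simp
    · exact (SimpleGraph.dist_eq_one_iff_adj.2 (by simpa using h)).le
  · simp

/-- A one-vertex graph has an edgeless blow-up, so this case is separated; here properness at the
fixed vertex bounds the whole group. -/
lemma finite_of_isProperAction_of_subsingleton {V : Type u} {Γ : SimpleGraph V}
    {φ : G →* (Γ ≃g Γ)} (hφ : IsProperAction φ) [Subsingleton V] [Nonempty V] : Finite G := by
  obtain ⟨v⟩ := ‹Nonempty V›
  have := hφ {v}
  have h : {g : G | ∃ w ∈ ({v} : Finset V), φ g w ∈ ({v} : Finset V)} = Set.univ :=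
    Set.eq_univ_of_forall fun g => ⟨v, by simp, by simpa using Subsingleton.elim _ _⟩
  rw [h] at this
  exact Set.finite_univ_iff.1 this

/-- A shortcut group acts freely and cocompactly on a shortcut graph. -/
theorem IsShortcutGroup.exists_equivariantGraph (hG : IsShortcutGroup G) :
    ∃ (T : Type u) (_ : Finite T) (Δ : SimpleGraph (FreeSet G T)) (color : T → Fin 3),
      IsEquivariantGraph Δ color ∧ IsShortcutGraph Δ := by
  obtain ⟨V, Γ, φ, hnt, hΓ, hφ, S, hS, hS'⟩ : ∃ (V : Type u) (Γ : SimpleGraph V)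
      (φ : G →* (Γ ≃g Γ)), Nontrivial V ∧ IsShortcutGraph Γ ∧ IsProperAction φ ∧
        IsCocompactAction φ := by
    obtain ⟨V, Γ, φ, hΓ, hφ, hS⟩ := hG
    rcases subsingleton_or_nontrivial V with h | h
    · have := hΓ.1.nonempty
      have := finite_of_isProperAction_of_subsingleton hφ
      obtain ⟨V, Γ, φ, h1, h2, h3⟩ := exists_nontrivial_of_finite (G := G)
      exact ⟨V, Γ, φ, h1, h2.isShortcutGraph, h3⟩
    · exact ⟨V, Γ, φ, h, hΓ, hφ, hS⟩
  exact ⟨S × Fin 3, inferInstance, blowUp φ S, _, isEquivariantGraph_blowUp φ hφ hS',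
    hΓ.of_hom (connected_blowUp φ hΓ.1 hS hnt) (blowUpHom φ S) (dist_blowUp_le φ hΓ.1 hS hnt)⟩

/-- A strongly shortcut group acts freely and cocompactly on a strongly shortcut graph. -/
theorem IsStronglyShortcutGroup.exists_equivariantGraph (hG : IsStronglyShortcutGroup G) :
    ∃ (T : Type u) (_ : Finite T) (Δ : SimpleGraph (FreeSet G T)) (color : T → Fin 3),
      IsEquivariantGraph Δ color ∧ IsStronglyShortcutGraph Δ := by
  obtain ⟨V, Γ, φ, hnt, hΓ, hφ, S, hS, hS'⟩ : ∃ (V : Type u) (Γ : SimpleGraph V)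
      (φ : G →* (Γ ≃g Γ)), Nontrivial V ∧ IsStronglyShortcutGraph Γ ∧ IsProperAction φ ∧
        IsCocompactAction φ := by
    obtain ⟨V, Γ, φ, hΓ, hφ, hS⟩ := hG
    rcases subsingleton_or_nontrivial V with h | h
    · have := hΓ.1.nonempty
      have := finite_of_isProperAction_of_subsingleton hφ
      exact exists_nontrivial_of_finite
    · exact ⟨V, Γ, φ, h, hΓ, hφ, hS⟩
  exact ⟨S × Fin 3, inferInstance, blowUp φ S, _, isEquivariantGraph_blowUp φ hφ hS',
    hΓ.of_hom (connected_blowUp φ hΓ.1 hS hnt) (blowUpHom φ S) (dist_blowUp_le φ hΓ.1 hS hnt)⟩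

end FreeActions

end Shortcut

namespace Shortcut

open Set Metric Topology

section Attaching

/-! ### Attaching cells -/

/-- An attaching map for an `n`-cell: a continuous map on the boundary of the unit cube, extended
radially to the complement of the centre. -/
structure AttachingMap (n : ℕ) (Y : Type*) [TopologicalSpace Y] where
  toFun : (Fin n → ℝ) → Y
  continuousOn : ContinuousOn toFun {0}ᶜ
  smul_eq : ∀ (c : ℝ) (x : Fin n → ℝ), 0 < c → toFun (c • x) = toFun x

instance (n : ℕ) (Y : Type*) [TopologicalSpace Y] :
    CoeFun (AttachingMap n Y) fun _ => (Fin n → ℝ) → Y := ⟨AttachingMap.toFun⟩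

/-- The space obtained from `Y` by attaching `n`-cells, as the disjoint union of `Y` and the open
cells. -/
inductive Attach {n : ℕ} {Y : Type u} [TopologicalSpace Y] {B : Type u}
    (φ : B → AttachingMap n Y) : Type u
  | base (y : Y) : Attach φ
  | cell (b : B) (x : ball (0 : Fin n → ℝ) 1) : Attach φ

namespace Attach

variable {n : ℕ} {Y : Type u} [TopologicalSpace Y] {B : Type u} {φ : B → AttachingMap n Y}

open Classical in
/-- The characteristic map of an attached cell, extended radially to the whole space. -/
noncomputable def char (φ : B → AttachingMap n Y) (b : B) (x : Fin n → ℝ) : Attach φ :=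
  if h : x ∈ ball 0 1 then cell b ⟨x, h⟩ else base (φ b x)

lemma char_of_norm_lt {b : B} {x : Fin n → ℝ} (h : ‖x‖ < 1) :
    char φ b x = cell b ⟨x, by simpa using h⟩ := dif_pos _

lemma char_of_le_norm {b : B} {x : Fin n → ℝ} (h : 1 ≤ ‖x‖) : char φ b x = base (φ b x) :=
  dif_neg (by simpa using h)

lemma char_coe (b : B) (x : ball (0 : Fin n → ℝ) 1) : char φ b x = cell b x := dif_pos x.2

noncomputable instance : TopologicalSpace (Attach φ) :=
  .coinduced base inferInstance ⊔ ⨆ b, .coinduced (char φ b) inferInstance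

lemma isOpen_iff {U : Set (Attach φ)} :
    IsOpen U ↔ IsOpen (base ⁻¹' U) ∧ ∀ b, IsOpen (char φ b ⁻¹' U) := by
  refine isOpen_sup.trans (and_congr isOpen_coinduced (isOpen_iSup_iff.trans ?_))
  exact forall_congr' fun b => isOpen_coinduced

lemma isClosed_iff {U : Set (Attach φ)} :
    IsClosed U ↔ IsClosed (base ⁻¹' U) ∧ ∀ b, IsClosed (char φ b ⁻¹' U) := by
  simp only [← isOpen_compl_iff, isOpen_iff, preimage_compl]

lemma continuous_base : Continuous (base : Y → Attach φ) :=
  continuous_def.2 fun _ hU => (isOpen_iff.1 hU).1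

lemma continuous_char (b : B) : Continuous (char φ b) :=
  continuous_def.2 fun _ hU => (isOpen_iff.1 hU).2 b

lemma continuousOn_iff {Z : Type*} [TopologicalSpace Z] {O : Set (Attach φ)} (hO : IsOpen O)
    {f : Attach φ → Z} : ContinuousOn f O ↔ ContinuousOn (f ∘ base) (base ⁻¹' O) ∧
      ∀ b, ContinuousOn (f ∘ char φ b) (char φ b ⁻¹' O) := by
  have h1 := (isOpen_iff.1 hO).1
  have h2 := fun b => (isOpen_iff.1 hO).2 b
  simp only [continuousOn_open_iff hO, continuousOn_open_iff h1, continuousOn_open_iff (h2 _),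
    isOpen_iff, preimage_inter, preimage_comp]
  exact ⟨fun h => ⟨fun t ht => (h t ht).1, fun b t ht => (h t ht).2 b⟩,
    fun h t ht => ⟨h.1 t ht, fun b => h.2 b t ht⟩⟩

lemma continuous_iff {Z : Type*} [TopologicalSpace Z] {f : Attach φ → Z} :
    Continuous f ↔ Continuous (f ∘ base) ∧ ∀ b, Continuous (f ∘ char φ b) := by
  simp only [← continuousOn_univ, continuousOn_iff isOpen_univ, preimage_univ]

/-- A subset of `Y` enlarged by the open collars of the attached cells. -/
def thicken (φ : B → AttachingMap n Y) (U : Set Y) : Set (Attach φ)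
  | base y => y ∈ U
  | cell b x => (x : Fin n → ℝ) ≠ 0 ∧ φ b x ∈ U

lemma ne_zero_of_le_norm {x : Fin n → ℝ} (h : 1 ≤ ‖x‖) : x ≠ 0 := by
  rintro rfl
  simp at h
  linarith

lemma char_mem_thicken {U : Set Y} {b : B} {x : Fin n → ℝ} :
    char φ b x ∈ thicken φ U ↔ x ≠ 0 ∧ φ b x ∈ U := by
  rcases lt_or_ge ‖x‖ 1 with h | h
  · rw [char_of_norm_lt h]; rfl
  · rw [char_of_le_norm h, and_iff_right (ne_zero_of_le_norm h)]; rfl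

lemma isOpen_thicken {U : Set Y} (hU : IsOpen U) : IsOpen (thicken φ U) := by
  refine isOpen_iff.2 ⟨hU, fun b => ?_⟩
  have : char φ b ⁻¹' thicken φ U = {0}ᶜ ∩ φ b ⁻¹' U := by
    ext x; exact char_mem_thicken
  rw [this]
  exact (φ b).continuousOn.isOpen_inter_preimage isOpen_compl_singleton hU

lemma disjoint_thicken {U U' : Set Y} (h : Disjoint U U') :
    Disjoint (thicken φ U) (thicken φ U') := by
  rw [Set.disjoint_left] at h ⊢
  rintro (y | ⟨b, x⟩) h1 h2
  · exact h h1 h2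
  · exact h h1.2 h2.2

/-- The part of an open cell given by a subset of the open unit cube. -/
lemma isOpen_cell_image {U : Set (Fin n → ℝ)} (hU : IsOpen U) (b : B) :
    IsOpen (cell b '' (Subtype.val ⁻¹' U) : Set (Attach φ)) := by
  refine isOpen_iff.2 ⟨?_, fun b' => ?_⟩
  · have : base ⁻¹' (cell b '' (Subtype.val ⁻¹' U) : Set (Attach φ)) = ∅ := by
      ext y; simp
    rw [this]; exact isOpen_empty
  · by_cases hb : b' = b
    · subst hb
      have : char φ b' ⁻¹' (cell b' '' (Subtype.val ⁻¹' U)) = ball 0 1 ∩ U := by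
        ext x
        rcases lt_or_ge ‖x‖ 1 with h | h
        · simp [char_of_norm_lt h, h]
        · simp [char_of_le_norm h, h]
      rw [this]; exact isOpen_ball.inter hU
    · have : char φ b' ⁻¹' (cell b '' (Subtype.val ⁻¹' U)) = ∅ := by
        ext x
        rcases lt_or_ge ‖x‖ 1 with h | h
        · simp [char_of_norm_lt h, Ne.symm hb]
        · simp [char_of_le_norm h]
      rw [this]; exact isOpen_empty

/-- The complement of a smaller closed concentric cube in a cell is open. -/
lemma isOpen_compl_cell_image (r : ℝ) (hr : r < 1) (b : B) :
    IsOpen (cell b '' (Subtype.val ⁻¹' closedBall 0 r) : Set (Attach φ))ᶜ := by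
  refine isOpen_iff.2 ⟨?_, fun b' => ?_⟩
  · have : base ⁻¹' (cell b '' (Subtype.val ⁻¹' closedBall 0 r) : Set (Attach φ))ᶜ = univ := by
      ext y; simp
    rw [this]; exact isOpen_univ
  · by_cases hb : b' = b
    · subst hb
      have : char φ b' ⁻¹' (cell b' '' (Subtype.val ⁻¹' closedBall 0 r))ᶜ =
          (closedBall 0 r)ᶜ := by
        ext x
        rcases lt_or_ge ‖x‖ 1 with h | h
        · simp [char_of_norm_lt h]
        · simp [char_of_le_norm h, hr.trans_le h]
      rw [this]; exact isClosed_closedBall.isOpen_compl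
    · have : char φ b' ⁻¹' (cell b '' (Subtype.val ⁻¹' closedBall 0 r))ᶜ = univ := by
        ext x
        rcases lt_or_ge ‖x‖ 1 with h | h
        · simp [char_of_norm_lt h, Ne.symm hb]
        · simp [char_of_le_norm h]
      rw [this]; exact isOpen_univ

/-- A concentric cube of radius strictly between `‖x‖` and 1 separates the point from everything
outside the cell. -/
lemma exists_disjoint_nhds_cell (b : B) (x : ball (0 : Fin n → ℝ) 1) (p : Attach φ)
    (hp : p ∉ range (cell b)) :
    ∃ U U' : Set (Attach φ), IsOpen U ∧ IsOpen U' ∧ cell b x ∈ U ∧ p ∈ U' ∧ Disjoint U U' := by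
  have hx : ‖(x : Fin n → ℝ)‖ < 1 := mem_ball_zero_iff.1 x.2
  obtain ⟨r, hr, hr1⟩ := exists_between hx
  refine ⟨_, _, isOpen_cell_image (isOpen_ball (x := 0) (ε := r)) b,
    isOpen_compl_cell_image r hr1 b,
    ⟨x, by simpa using hr, rfl⟩, fun ⟨z, _, hz⟩ => hp ⟨z, hz⟩, ?_⟩
  rw [disjoint_compl_right_iff_subset]
  exact image_mono (preimage_mono ball_subset_closedBall)

lemma cell_injective (b : B) : Function.Injective (cell b : _ → Attach φ) :=
  fun _ _ h => by injection h

lemma base_injective : Function.Injective (base : Y → Attach φ) :=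
  fun _ _ h => by injection h

instance [T2Space Y] : T2Space (Attach φ) := by
  refine ⟨fun p q hpq => ?_⟩
  match p, q, hpq with
  | base y, base y', h =>
    obtain ⟨U, U', h1, h2, h3, h4, h5⟩ := t2_separation (fun e => h (congrArg base e) : y ≠ y')
    exact ⟨_, _, isOpen_thicken h1, isOpen_thicken h2, h3, h4, disjoint_thicken h5⟩
  | cell b x, base y, _ => exact exists_disjoint_nhds_cell b x _ (by simp)
  | base y, cell b x, _ =>
    obtain ⟨U, U', h1, h2, h3, h4, h5⟩ := exists_disjoint_nhds_cell b x (base y : Attach φ)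
      (by simp)
    exact ⟨U', U, h2, h1, h4, h3, h5.symm⟩
  | cell b x, cell b' x', h =>
    by_cases hb : b = b'
    · subst hb
      have hx : (x : Fin n → ℝ) ≠ x' := fun e => h (by rw [Subtype.ext e])
      obtain ⟨U, U', h1, h2, h3, h4, h5⟩ := t2_separation hx
      refine ⟨_, _, isOpen_cell_image h1 b, isOpen_cell_image h2 b, ⟨x, h3, rfl⟩, ⟨x', h4, rfl⟩, ?_⟩
      exact (disjoint_image_iff (cell_injective b)).2 (h5.preimage _)
    · exact exists_disjoint_nhds_cell b x _ (by simpa using hb)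

/-- Every open subset of `Y` is the trace of an open set, its `thicken`. -/
lemma isEmbedding_base : IsEmbedding (base : Y → Attach φ) := by
  refine ⟨⟨le_antisymm (continuous_iff_le_induced.1 continuous_base) fun U hU => ?_⟩,
    base_injective⟩
  exact ⟨thicken φ U, isOpen_thicken hU, rfl⟩

lemma char_smul_of_le_norm {b : B} {c : ℝ} {x : Fin n → ℝ} (hx : 1 ≤ ‖x‖) (hc : 0 < c)
    (hcx : 1 ≤ ‖c • x‖) : char φ b (c • x) = char φ b x := by
  rw [char_of_le_norm hx, char_of_le_norm hcx, (φ b).smul_eq _ _ hc]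

/-- By scale invariance, a point outside the cube has the same image as its radial projection to the
boundary. -/
lemma range_char (b : B) : range (char φ b) = char φ b '' closedBall 0 1 := by
  refine subset_antisymm ?_ (image_subset_range _ _)
  rintro _ ⟨x, rfl⟩
  rcases le_or_gt ‖x‖ 1 with h | h
  · exact ⟨x, by simpa using h, rfl⟩
  · have h0 : 0 < ‖x‖ := by linarith
    have h1 : ‖‖x‖⁻¹ • x‖ = 1 := by
      rw [norm_smul, norm_inv, norm_norm, inv_mul_cancel₀ h0.ne']
    exact ⟨‖x‖⁻¹ • x, by simp [h1], char_smul_of_le_norm h.le (inv_pos.2 h0) h1.ge⟩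

lemma exists_char_or_base (p : Attach φ) : (∃ y, p = base y) ∨ ∃ b x, ‖x‖ < 1 ∧ p = char φ b x := by
  cases p with
  | base y => exact .inl ⟨y, rfl⟩
  | cell b x => exact .inr ⟨b, x, mem_ball_zero_iff.1 x.2, (char_coe b x).symm⟩

lemma compactSpace [CompactSpace Y] [Finite B] : CompactSpace (Attach φ) := by
  refine ⟨?_⟩
  have : (univ : Set (Attach φ)) = range base ∪ ⋃ b, char φ b '' closedBall 0 1 := by
    symm
    rw [eq_univ_iff_forall]
    intro p
    rcases exists_char_or_base p with ⟨y, rfl⟩ | ⟨b, x, -, rfl⟩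
    · exact .inl ⟨y, rfl⟩
    · exact .inr (mem_iUnion.2 ⟨b, by rw [← range_char]; exact ⟨x, rfl⟩⟩)
  rw [this]
  exact (isCompact_range continuous_base).union
    (isCompact_iUnion fun b => (isCompact_closedBall _ _).image (continuous_char b))

/-- A closed subset of the space obtained by attaching cells is detected on the base and on the
closed cells. -/
lemma isClosed_of_inter_closedCell [T2Space Y] {A : Set (Attach φ)} (h0 : IsClosed (base ⁻¹' A))
    (h : ∀ b, IsClosed (A ∩ char φ b '' closedBall 0 1)) : IsClosed A := by
  refine isClosed_iff.2 ⟨h0, fun b => ?_⟩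
  have := (h b).preimage (continuous_char b)
  rwa [← range_char, preimage_inter_range] at this

open Classical in
/-- The inverse of the characteristic map of a cell. -/
noncomputable def coord (b : B) : Attach φ → (Fin n → ℝ)
  | base _ => 0
  | cell b' x => if b' = b then x else 0

lemma coord_char {b : B} {x : Fin n → ℝ} (h : ‖x‖ < 1) : coord b (char φ b x) = x := by
  simp [char_of_norm_lt h, coord]

/-- The characteristic map of a cell as a partial equivalence. -/
noncomputable def charEquiv (φ : B → AttachingMap n Y) (b : B) :
    PartialEquiv (Fin n → ℝ) (Attach φ) where
  toFun := char φ b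
  invFun := coord b
  source := ball 0 1
  target := char φ b '' ball 0 1
  map_source' x hx := ⟨x, hx, rfl⟩
  map_target' := by
    rintro _ ⟨x, hx, rfl⟩
    rwa [coord_char (by simpa using hx)]
  left_inv' x hx := coord_char (by simpa using hx)
  right_inv' := by
    rintro _ ⟨x, hx, rfl⟩
    rw [coord_char (by simpa using hx)]

lemma char_image_ball (b : B) (U : Set (Fin n → ℝ)) :
    char φ b '' (ball 0 1 ∩ U) = cell b '' (Subtype.val ⁻¹' U) := by
  ext p
  constructor
  · rintro ⟨x, ⟨hx, hU⟩, rfl⟩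
    exact ⟨⟨x, hx⟩, hU, (char_coe b ⟨x, hx⟩).symm⟩
  · rintro ⟨x, hU, rfl⟩
    exact ⟨x, ⟨x.2, hU⟩, char_coe b x⟩

lemma isOpen_char_image_ball (b : B) : IsOpen (char φ b '' ball 0 1) := by
  have := isOpen_cell_image (φ := φ) isOpen_univ b
  rwa [← char_image_ball, inter_univ] at this

lemma continuousOn_coord (b : B) : ContinuousOn (coord b : Attach φ → _)
    (char φ b '' ball 0 1) := by
  refine (continuousOn_open_iff (isOpen_char_image_ball b)).2 fun U hU => ?_
  have : char φ b '' ball 0 1 ∩ coord b ⁻¹' U = cell b '' (Subtype.val ⁻¹' U) := by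
    rw [← char_image_ball]
    ext p
    constructor
    · rintro ⟨⟨x, hx, rfl⟩, hU⟩
      rw [mem_preimage, coord_char (by simpa using hx)] at hU
      exact ⟨x, ⟨hx, hU⟩, rfl⟩
    · rintro ⟨x, ⟨hx, hU⟩, rfl⟩
      refine ⟨⟨x, hx, rfl⟩, ?_⟩
      rwa [mem_preimage, coord_char (by simpa using hx)]
  rw [this]
  exact isOpen_cell_image hU b

end Attach

end Attaching

end Shortcut

namespace Shortcut

open Set Metric Topology
open scoped unitInterval

section PathClasses

/-! ### Path classes -/

variable {X : Type*} [TopologicalSpace X]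

lemma of_mk_cast (M : ∀ {x y : X}, Path.Homotopic.Quotient x y → Prop) {x y x' y' : X}
    (γ : Path x y) (hx : x' = x) (hy : y' = y) (h : M (Path.Homotopic.Quotient.mk (γ.cast hx hy))) :
    M (Path.Homotopic.Quotient.mk γ) := by
  subst hx hy
  exact h

/-- A property of path classes which is stable under concatenation and holds locally holds for all
path classes. -/
theorem path_class_induction (M : ∀ {x y : X}, Path.Homotopic.Quotient x y → Prop)
    (htrans : ∀ {x y z : X} (γ : Path.Homotopic.Quotient x y) (δ : Path.Homotopic.Quotient y z),
      M γ → M δ → M (γ.trans δ))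
    (hloc : ∀ x : X, ∃ U : Set X, IsOpen U ∧ x ∈ U ∧
      ∀ {a b : X} (γ : Path a b), (∀ t, γ t ∈ U) → M (Path.Homotopic.Quotient.mk γ))
    {x y : X} (γ : Path.Homotopic.Quotient x y) : M γ := by
  induction γ with | mk γ =>
  choose U hU hxU hM using hloc
  obtain ⟨t, ht0, hmono, ⟨n, hn⟩, hsub⟩ := exists_monotone_Icc_subset_open_cover_unitInterval
    (c := fun x => γ ⁻¹' U x) (fun x => (hU x).preimage γ.continuous)
    (fun s _ => mem_iUnion.2 ⟨γ s, hxU _⟩)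
  have key : ∀ n, M (Path.Homotopic.Quotient.mk (γ.subpath (t 0) (t n))) := by
    intro n
    induction n with
    | zero =>
      refine hM (γ (t 0)) _ fun s => ?_
      simpa using hxU (γ (t 0))
    | succ n ih =>
      have h := Path.Homotopic.Quotient.eq.2
          ⟨Path.Homotopy.subpathTransSubpath γ (t 0) (t n) (t (n + 1))⟩
      rw [← h, Path.Homotopic.Quotient.mk_trans]
      refine htrans _ _ ih ?_
      obtain ⟨i, hi⟩ := hsub n
      refine hM i _ fun s => ?_
      have : γ.subpath (t n) (t (n + 1)) s ∈ range (γ.subpath (t n) (t (n + 1))) := ⟨s, rfl⟩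
      rw [Path.range_subpath_of_le _ _ _ (hmono n.le_succ)] at this
      obtain ⟨r, hr, hr'⟩ := this
      rw [← hr']
      exact hi hr
  have h1 := key n
  rw [ht0, hn n le_rfl, Path.subpath_zero_one] at h1
  exact of_mk_cast M γ _ _ h1

lemma symm_trans_symm {x y z : X} (a : Path.Homotopic.Quotient x y)
    (c : Path.Homotopic.Quotient x z) : (a.symm.trans c).symm = c.symm.trans a := by
  induction a with | mk a =>
  induction c with | mk c =>
  change Path.Homotopic.Quotient.mk (a.symm.trans c).symm =
    Path.Homotopic.Quotient.mk (c.symm.trans a)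
  rw [Path.trans_symm, Path.symm_symm]

/-- All homotopies of paths below come from here: two paths factoring through a simply connected
space with common ends there are homotopic. -/
lemma homotopic_of_factor {A : Type*} [TopologicalSpace A] [SimplyConnectedSpace A] {p q : X}
    {γ γ' : Path p q} (f : C(A, X)) {a b : A} (δ δ' : Path a b) (h : ∀ t, γ t = f (δ t))
    (h' : ∀ t, γ' t = f (δ' t)) : γ.Homotopic γ' := by
  obtain rfl : p = f a := by simpa using h 0
  obtain rfl : q = f b := by simpa using h 1
  obtain rfl : γ = δ.map f.continuous := by ext t; exact h t
  obtain rfl : γ' = δ'.map f.continuous := by ext t; exact h' t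
  exact (SimplyConnectedSpace.paths_homotopic δ δ').map f

lemma trans_eq_of_factor {A : Type*} [TopologicalSpace A] {p q r : X} {γ : Path p q} {γ' : Path q r}
    (f : A → X) {a b c : A} (δ : Path a b) (δ' : Path b c) (h : ∀ t, γ t = f (δ t))
    (h' : ∀ t, γ' t = f (δ' t)) (t : I) : γ.trans γ' t = f (δ.trans δ' t) := by
  simp only [Path.trans_apply]
  split_ifs <;> simp [h, h']

/-- The naturality square of a homotopy along a path. -/
lemma trans_eq_trans_of_square {p q p' q' : X} (K : C(I × I, X)) (α : Path p q) (β : Path p' q')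
    (hp : Path p p') (hq : Path q q') (h1 : ∀ s, K (s, 0) = α s) (h2 : ∀ s, K (s, 1) = β s)
    (h3 : ∀ t, K (0, t) = hp t) (h4 : ∀ t, K (1, t) = hq t) :
    (Path.Homotopic.Quotient.mk α).trans (Path.Homotopic.Quotient.mk hq) =
        (Path.Homotopic.Quotient.mk hp).trans (Path.Homotopic.Quotient.mk β) := by
  rw [← Path.Homotopic.Quotient.mk_trans, ← Path.Homotopic.Quotient.mk_trans,
      Path.Homotopic.Quotient.eq]
  -- Clamping the coordinates extends the square to the plane, a simply connected space in which the
  -- two boundary routes are homotopic.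
  let f : C(ℝ × ℝ, X) := K.comp
    ⟨fun x => (projIcc 0 1 zero_le_one x.1, projIcc 0 1 zero_le_one x.2), by fun_prop⟩
  have hf : ∀ s t : I, f ((s : ℝ), (t : ℝ)) = K (s, t) := fun s t => by simp [f]
  let b : Path ((0 : ℝ), (0 : ℝ)) (1, 0) := ⟨⟨fun s => (s, 0), by fun_prop⟩, by simp, by simp⟩
  let r : Path ((1 : ℝ), (0 : ℝ)) (1, 1) := ⟨⟨fun s => (1, s), by fun_prop⟩, by simp, by simp⟩
  let l : Path ((0 : ℝ), (0 : ℝ)) (0, 1) := ⟨⟨fun s => (0, s), by fun_prop⟩, by simp, by simp⟩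
  let t : Path ((0 : ℝ), (1 : ℝ)) (1, 1) := ⟨⟨fun s => (s, 1), by fun_prop⟩, by simp, by simp⟩
  refine homotopic_of_factor f (b.trans r) (l.trans t) ?_ ?_
  · exact trans_eq_of_factor f b r (fun s => (h1 s).symm.trans (hf s 0).symm)
      (fun s => (h4 s).symm.trans (hf 1 s).symm)
  · exact trans_eq_of_factor f l t (fun s => (h3 s).symm.trans (hf 0 s).symm)
      (fun s => (h2 s).symm.trans (hf s 1).symm)

end PathClasses

namespace Attach

/-! ### The fundamental groupoid of a space obtained by attaching cells -/

variable {n : ℕ} {Y : Type u} [TopologicalSpace Y] {B : Type u} {φ : B → AttachingMap n Y}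

/-- The image of a straight segment in a cell. -/
noncomputable def diskPath (b : B) (x z : Fin n → ℝ) {p q : Attach φ} (hx : char φ b x = p)
    (hz : char φ b z = q) : Path p q where
  toFun t := char φ b (AffineMap.lineMap x z (t : ℝ))
  continuous_toFun := (continuous_char b).comp (by fun_prop)
  source' := by simpa using hx
  target' := by simpa using hz

/-- The straight segment as a path. -/
noncomputable def segmentPath (x z : Fin n → ℝ) : Path x z where
  toFun t := AffineMap.lineMap x z (t : ℝ)
  continuous_toFun := by fun_prop
  source' := by simp
  target' := by simp

lemma mk_eq_mk_diskPath {b : B} {x z : Fin n → ℝ} {p q : Attach φ} (hx : char φ b x = p)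
    (hz : char φ b z = q) (γ : Path p q) (δ : Path x z) (h : ∀ t, γ t = char φ b (δ t)) :
    Path.Homotopic.Quotient.mk γ = Path.Homotopic.Quotient.mk (diskPath b x z hx hz) :=
  Path.Homotopic.Quotient.eq.2
    (homotopic_of_factor ⟨char φ b, continuous_char b⟩ δ (segmentPath x z) h
    fun _ => rfl)

lemma diskPath_trans {b : B} {x y z : Fin n → ℝ} {p q r : Attach φ} (hx : char φ b x = p)
    (hy : char φ b y = q) (hz : char φ b z = r) :
    (Path.Homotopic.Quotient.mk (diskPath b x y hx hy)).trans
        (Path.Homotopic.Quotient.mk (diskPath b y z hy hz)) =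
      Path.Homotopic.Quotient.mk (diskPath b x z hx hz) :=
  mk_eq_mk_diskPath hx hz _ ((segmentPath x y).trans (segmentPath y z))
    (trans_eq_of_factor _ _ _ (fun _ => rfl) (fun _ => rfl))

lemma diskPath_symm {b : B} {x z : Fin n → ℝ} {p q : Attach φ} (hx : char φ b x = p)
    (hz : char φ b z = q) : (Path.Homotopic.Quotient.mk (diskPath b x z hx hz)).symm =
      Path.Homotopic.Quotient.mk (diskPath b z x hz hx) :=
  mk_eq_mk_diskPath hz hx _ (segmentPath x z).symm fun _ => rfl

lemma diskPath_self {b : B} {x : Fin n → ℝ} {p : Attach φ} (hx : char φ b x = p) :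
    Path.Homotopic.Quotient.mk (diskPath b x x hx hx) = Path.Homotopic.Quotient.refl p :=
  (mk_eq_mk_diskPath hx hx (Path.refl p) (Path.refl x) fun _ => hx.symm).symm

/-- The radial retraction of the complement of the centres of the cells. -/
def ret : Attach φ → Y
  | base y => y
  | cell b x => φ b x

lemma ret_char (b : B) (x : Fin n → ℝ) : ret (char φ b x) = φ b x := by
  rcases lt_or_ge ‖x‖ 1 with h | h
  · rw [char_of_norm_lt h]; rfl
  · rw [char_of_le_norm h]; rfl

lemma continuousOn_ret : ContinuousOn (ret : Attach φ → Y) (thicken φ univ) := by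
  refine (continuousOn_iff (isOpen_thicken isOpen_univ)).2 ⟨continuousOn_id, fun b => ?_⟩
  refine (φ b).continuousOn.congr_mono (fun x _ => ret_char b x) fun x hx => ?_
  exact (char_mem_thicken.1 hx).1

/-- The radial deformation of a cell to its boundary. -/
noncomputable def radial (x : Fin n → ℝ) (t : ℝ) : Fin n → ℝ := (1 - t + t / ‖x‖) • x

/-- The tracks of the radial deformation. -/
noncomputable def push : Attach φ → C(I, Attach φ)
  | base y => .const I (base y)
  | cell b x => ⟨fun t => char φ b (radial x t), (continuous_char b).comp (by
      unfold radial; fun_prop)⟩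

/-- Outside the open cube the deformation stays outside, at norm `(1 - t) ‖x‖ + t ≥ 1`, so both
sides are constant by scale invariance. -/
lemma push_char (b : B) (x : Fin n → ℝ) (t : I) :
    push (char φ b x) t = char φ b (radial x t) := by
  rcases lt_or_ge ‖x‖ 1 with h | h
  · rw [char_of_norm_lt h]; rfl
  · have h0 : 0 < ‖x‖ := by linarith
    have hc : 0 < 1 - (t : ℝ) + t / ‖x‖ := by
      rcases eq_or_lt_of_le t.2.1 with h1 | h1
      · rw [← h1]; norm_num
      · have := div_pos h1 h0
        have := t.2.2
        linarith
    rw [radial, char_smul_of_le_norm h hc, char_of_le_norm h]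
    · rfl
    · rw [norm_smul, Real.norm_of_nonneg hc.le, add_mul, div_mul_cancel₀ _ h0.ne']
      nlinarith [t.2.1, t.2.2]

lemma continuousOn_push : ContinuousOn (push : Attach φ → C(I, Attach φ)) (thicken φ univ) := by
  refine (continuousOn_iff (isOpen_thicken isOpen_univ)).2 ⟨?_, fun b => ?_⟩
  · exact (ContinuousMap.continuous_const'.comp continuous_base).continuousOn
  · have hsub : char φ b ⁻¹' thicken φ univ ⊆ {0}ᶜ := fun x hx => (char_mem_thicken.1 hx).1
    refine ContinuousOn.mono ?_ hsub
    rw [continuousOn_iff_continuous_domRestrict]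
    let F : C(({0}ᶜ : Set (Fin n → ℝ)) × I, Attach φ) :=
      ⟨fun z => char φ b (radial z.1 z.2), (continuous_char b).comp (by
        unfold radial
        have : ∀ z : ({0}ᶜ : Set (Fin n → ℝ)) × I, ‖(z.1 : Fin n → ℝ)‖ ≠ 0 := fun z =>
          norm_ne_zero_iff.2 z.1.2
        fun_prop (disch := assumption))⟩
    convert F.curry.continuous using 1
    ext x t
    exact push_char b x.1 t

lemma norm_inv_norm_smul {x : Fin n → ℝ} (hx : x ≠ 0) : ‖‖x‖⁻¹ • x‖ = 1 := by
  rw [norm_smul, norm_inv, norm_norm, inv_mul_cancel₀ (norm_ne_zero_iff.2 hx)]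

lemma push_zero {p : Attach φ} (hp : p ∈ thicken φ univ) : push p 0 = p := by
  rcases exists_char_or_base p with ⟨y, rfl⟩ | ⟨b, x, -, rfl⟩
  · rfl
  · rw [push_char]
    simp [radial]

lemma push_one {p : Attach φ} (hp : p ∈ thicken φ univ) : push p 1 = base (ret p) := by
  rcases exists_char_or_base p with ⟨y, rfl⟩ | ⟨b, x, hx, rfl⟩
  · rfl
  · have h0 := (char_mem_thicken.1 hp).1
    have : radial x ((1 : I) : ℝ) = ‖x‖⁻¹ • x := by simp [radial]
    rw [push_char, ret_char, this, char_of_le_norm (norm_inv_norm_smul h0).ge,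
      (φ b).smul_eq _ _ (inv_pos.2 (norm_pos_iff.2 h0))]

/-- The track of a point under the radial deformation. -/
noncomputable def pushPath {p : Attach φ} (hp : p ∈ thicken φ univ) : Path p (base (ret p)) where
  toContinuousMap := push p
  source' := push_zero hp
  target' := push_one hp

/-- The radial deformation moves a path to the base. -/
lemma mk_trans_pushPath {p q : Attach φ} (γ : Path p q) (hγ : ∀ t, γ t ∈ thicken φ univ)
    (hp : p ∈ thicken φ univ) (hq : q ∈ thicken φ univ) :
    ∃ δ : Path (ret p) (ret q), (Path.Homotopic.Quotient.mk γ).trans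
        (Path.Homotopic.Quotient.mk (pushPath hq)) =
      (Path.Homotopic.Quotient.mk (pushPath hp)).trans
          (Path.Homotopic.Quotient.mk (δ.map continuous_base)) := by
  have hret : Continuous fun s => ret (γ s) :=
    continuousOn_ret.comp_continuous γ.continuous hγ
  have hpush : Continuous fun s => push (γ s) :=
    continuousOn_push.comp_continuous γ.continuous hγ
  refine ⟨⟨⟨fun s => ret (γ s), hret⟩, by simp, by simp⟩, ?_⟩
  let K : C(I × I, Attach φ) := ⟨fun z => push (γ z.1) z.2,
    ContinuousMap.continuous_uncurry_of_continuous ⟨_, hpush⟩⟩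
  refine trans_eq_trans_of_square K γ _ _ _ (fun s => push_zero (hγ s)) (fun s => push_one (hγ s))
    (fun t => ?_) (fun t => ?_)
  · change push (γ 0) t = push p t
    rw [γ.source]
  · change push (γ 1) t = push q t
    rw [γ.target]

/-- The end of the standard path from a point to the base. -/
def tail (p₀ : Fin n → ℝ) : Attach φ → Attach φ
  | base y => base y
  | cell b _ => base (φ b p₀)

/-- The standard path from a point to the base. -/
noncomputable def tether {p₀ : Fin n → ℝ} (hp₀ : ‖p₀‖ = 1) : ∀ p : Attach φ, Path p (tail p₀ p)
  | base y => Path.refl (base y)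
  | cell b x => diskPath b x p₀ (char_coe b x) (char_of_le_norm hp₀.ge)

/-- The path class between points of the base obtained by means of the standard paths. -/
noncomputable def conj {p₀ : Fin n → ℝ} (hp₀ : ‖p₀‖ = 1) {p q : Attach φ}
    (γ : Path.Homotopic.Quotient p q) : Path.Homotopic.Quotient (tail p₀ p) (tail p₀ q) :=
  (Path.Homotopic.Quotient.mk (tether hp₀ p)).symm.trans
    (γ.trans (Path.Homotopic.Quotient.mk (tether hp₀ q)))

lemma conj_trans {p₀ : Fin n → ℝ} (hp₀ : ‖p₀‖ = 1) {p q r : Attach φ}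
    (γ : Path.Homotopic.Quotient p q) (δ : Path.Homotopic.Quotient q r) :
    conj hp₀ (γ.trans δ) = (conj hp₀ γ).trans (conj hp₀ δ) := by
  simp only [conj, Path.Homotopic.Quotient.trans_assoc]
  rw [← Path.Homotopic.Quotient.trans_assoc (Path.Homotopic.Quotient.mk (tether hp₀ q)),
    Path.Homotopic.Quotient.trans_symm, Path.Homotopic.Quotient.refl_trans]

lemma conj_base {p₀ : Fin n → ℝ} (hp₀ : ‖p₀‖ = 1) {y y' : Y}
    (γ : Path.Homotopic.Quotient (base y : Attach φ) (base y')) : conj hp₀ γ = γ := by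
  have e : ∀ {x : Attach φ}, (Path.Homotopic.Quotient.refl x).symm =
      Path.Homotopic.Quotient.refl x := fun {x} => by
    rw [← Path.Homotopic.Quotient.trans_refl (Path.Homotopic.Quotient.refl x).symm,
      Path.Homotopic.Quotient.symm_trans]
  have h : ∀ y : Y, tether hp₀ (base y : Attach φ) = Path.refl (base y) := fun _ => rfl
  have h' : conj hp₀ γ = (Path.Homotopic.Quotient.refl (base y)).symm.trans
    (γ.trans (Path.Homotopic.Quotient.refl (base y'))) := rfl
  rw [h', e, Path.Homotopic.Quotient.trans_refl, Path.Homotopic.Quotient.refl_trans]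

lemma conj_diskPath {p₀ : Fin n → ℝ} (hp₀ : ‖p₀‖ = 1) (b : B) (x z : ball (0 : Fin n → ℝ) 1) :
    conj hp₀ (Path.Homotopic.Quotient.mk (diskPath b x z (char_coe (φ := φ) b x) (char_coe b z))) =
      Path.Homotopic.Quotient.refl (base (φ b p₀)) := by
  have h : ∀ x, tether hp₀ (cell b x : Attach φ) =
    diskPath b x p₀ (char_coe b x) (char_of_le_norm hp₀.ge) := fun _ => rfl
  have h' : ∀ (T : Path (cell b x : Attach φ) (base (φ b p₀)))
      (T' : Path (cell b z : Attach φ) (base (φ b p₀)))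
      (_ : T = diskPath b x p₀ (char_coe b x) (char_of_le_norm hp₀.ge))
      (_ : T' = diskPath b z p₀ (char_coe b z) (char_of_le_norm hp₀.ge)),
      (Path.Homotopic.Quotient.mk T).symm.trans ((Path.Homotopic.Quotient.mk (diskPath b x z
        (char_coe (φ := φ) b x) (char_coe b z))).trans (Path.Homotopic.Quotient.mk T')) =
      Path.Homotopic.Quotient.refl (base (φ b p₀)) := by
    rintro T T' rfl rfl
    rw [diskPath_symm, diskPath_trans, diskPath_trans, diskPath_self]
  exact h' _ _ (h x) (h z)

/-- A property of path classes holds for all paths with ends in the base if it is stable under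
concatenation and inversion and holds for the paths in the base and for the paths in a cell which
join a fixed point of the boundary to another point of the boundary. -/
theorem path_induction (M : ∀ {p q : Attach φ}, Path.Homotopic.Quotient p q → Prop)
    (hrefl : ∀ y, M (Path.Homotopic.Quotient.refl (base y)))
    (htrans : ∀ {p q r : Attach φ} (γ : Path.Homotopic.Quotient p q)
      (δ : Path.Homotopic.Quotient q r), M γ → M δ → M (γ.trans δ))
    (hsymm : ∀ {p q : Attach φ} (γ : Path.Homotopic.Quotient p q), M γ → M γ.symm)
    (hbase : ∀ {y y' : Y} (δ : Path y y'), M (Path.Homotopic.Quotient.mk (δ.map continuous_base)))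
    {p₀ : Fin n → ℝ} (hp₀ : ‖p₀‖ = 1)
    (hdisk : ∀ (b : B) (z : Fin n → ℝ) (hz : ‖z‖ = 1), M
        (Path.Homotopic.Quotient.mk (diskPath b p₀ z
      (char_of_le_norm (φ := φ) hp₀.ge) (char_of_le_norm hz.ge))))
    {y y' : Y} (γ : Path.Homotopic.Quotient (base y : Attach φ) (base y')) : M γ := by
  -- The tether and the radial track of a point both lie in one closed cell, so together they amount
  -- to a segment from `p₀` to a boundary point, as in `hdisk`.
  have hend : ∀ p (hp : p ∈ thicken φ univ),
      M ((Path.Homotopic.Quotient.mk (tether hp₀ p)).symm.trans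
        (Path.Homotopic.Quotient.mk (pushPath hp))) := by
    intro p hp
    cases p with
    | base y =>
      have : pushPath hp = Path.refl (base y) := by ext t; rfl
      rw [this]
      change M ((Path.Homotopic.Quotient.mk (Path.refl (base y))).symm.trans
        (Path.Homotopic.Quotient.refl _))
      rw [Path.Homotopic.Quotient.trans_refl]
      exact hsymm _ (hrefl y)
    | cell b x =>
      have h0 : (x : Fin n → ℝ) ≠ 0 := hp.1
      have hz := norm_inv_norm_smul h0
      have e : φ b x = φ b (‖(x : Fin n → ℝ)‖⁻¹ • (x : Fin n → ℝ)) :=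
        ((φ b).smul_eq _ _ (inv_pos.2 (norm_pos_iff.2 h0))).symm
      have hx1 : char φ b (‖(x : Fin n → ℝ)‖⁻¹ • (x : Fin n → ℝ)) = base (φ b x) := by
        rw [e]; exact char_of_le_norm hz.ge
      have h1 : Path.Homotopic.Quotient.mk (pushPath hp) =
          Path.Homotopic.Quotient.mk (diskPath b x _ (char_coe b x) hx1) := by
        refine mk_eq_mk_diskPath _ _ _ ⟨⟨fun t => radial (x : Fin n → ℝ) t, ?_⟩, ?_, ?_⟩
          fun t => rfl
        · unfold radial; fun_prop
        · simp [radial]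
        · simp [radial]
      have key : ∀ (q : Y) (P : Path (cell b x : Attach φ) (base q))
          (T : Path (cell b x : Attach φ) (base (φ b p₀)))
          (hq : char φ b (‖(x : Fin n → ℝ)‖⁻¹ • (x : Fin n → ℝ)) = base q)
          (_ : Path.Homotopic.Quotient.mk P =
            Path.Homotopic.Quotient.mk (diskPath b x _ (char_coe b x) hq))
          (_ : T = diskPath b x p₀ (char_coe b x) (char_of_le_norm hp₀.ge)),
          M ((Path.Homotopic.Quotient.mk T).symm.trans (Path.Homotopic.Quotient.mk P)) := by
        intro q P T hq hP hT
        obtain rfl : φ b (‖(x : Fin n → ℝ)‖⁻¹ • (x : Fin n → ℝ)) = q :=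
          base_injective ((char_of_le_norm hz.ge).symm.trans hq)
        rw [hP, hT, diskPath_symm, diskPath_trans]
        exact hdisk b _ hz
      exact key _ (pushPath hp) (tether hp₀ (cell b x)) hx1 h1 rfl
  have hM : M (conj hp₀ γ) := by
    -- Conjugation by tethers respects concatenation, so it suffices to treat small paths: those in
    -- an open cell become trivial, and those missing all centres are pushed radially into the base.
    refine path_class_induction (M := fun γ => M (conj hp₀ γ)) (fun γ δ hγ hδ => ?_) (fun p => ?_) γ
    · rw [conj_trans]
      exact htrans _ _ hγ hδ
    cases p with
    | cell b x =>
      refine ⟨_, isOpen_char_image_ball b, ⟨x, x.2, char_coe b x⟩, fun {p q} γ hγ => ?_⟩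
      have hcell : ∀ p ∈ char φ b '' ball 0 1, ∃ x, p = cell b x := by
        rintro _ ⟨x, hx, rfl⟩
        exact ⟨⟨x, hx⟩, char_coe b ⟨x, hx⟩⟩
      obtain ⟨x, rfl⟩ := hcell p (by simpa using hγ 0)
      obtain ⟨z, rfl⟩ := hcell q (by simpa using hγ 1)
      have hc : Continuous fun t => coord b (γ t) :=
        (continuousOn_coord b).comp_continuous γ.continuous hγ
      have h1 : Path.Homotopic.Quotient.mk γ =
          Path.Homotopic.Quotient.mk (diskPath b x z (char_coe b x) (char_coe b z)) := by
        refine mk_eq_mk_diskPath _ _ _ ⟨⟨fun t => coord b (γ t), hc⟩, ?_, ?_⟩ fun t => ?_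
        · simp [coord]
        · simp [coord]
        · obtain ⟨w, hw⟩ := hcell _ (hγ t)
          change γ t = char φ b (coord b (γ t))
          rw [hw, ← char_coe, coord_char (mem_ball_zero_iff.1 w.2)]
      rw [h1, conj_diskPath]
      exact hrefl _
    | base y =>
      refine ⟨thicken φ univ, isOpen_thicken isOpen_univ, mem_univ y, fun {p q} γ hγ => ?_⟩
      have hp : p ∈ thicken φ univ := by simpa using hγ 0
      have hq : q ∈ thicken φ univ := by simpa using hγ 1
      obtain ⟨δ, hδ⟩ := mk_trans_pushPath γ hγ hp hq
      have e : conj hp₀ (Path.Homotopic.Quotient.mk γ) =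
          ((Path.Homotopic.Quotient.mk (tether hp₀ p)).symm.trans
              (Path.Homotopic.Quotient.mk (pushPath hp))).trans
          ((Path.Homotopic.Quotient.mk (δ.map continuous_base)).trans
            ((Path.Homotopic.Quotient.mk (tether hp₀ q)).symm.trans
                (Path.Homotopic.Quotient.mk (pushPath hq))).symm) := by
        have e1 : Path.Homotopic.Quotient.mk γ = (Path.Homotopic.Quotient.mk (pushPath hp)).trans
            ((Path.Homotopic.Quotient.mk (δ.map continuous_base)).trans
                (Path.Homotopic.Quotient.mk (pushPath hq)).symm) := by
          rw [← Path.Homotopic.Quotient.trans_assoc, ← hδ, Path.Homotopic.Quotient.trans_assoc,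
              Path.Homotopic.Quotient.trans_symm,
            Path.Homotopic.Quotient.trans_refl]
        have e2 : ((Path.Homotopic.Quotient.mk (tether hp₀ q)).symm.trans
            (Path.Homotopic.Quotient.mk (pushPath hq))).symm =
            (Path.Homotopic.Quotient.mk (pushPath hq)).symm.trans
                (Path.Homotopic.Quotient.mk (tether hp₀ q)) :=
          symm_trans_symm _ _
        rw [e1, e2, conj]
        simp only [Path.Homotopic.Quotient.trans_assoc]
      rw [e]
      exact htrans _ _ (hend p hp) (htrans _ _ (hbase δ) (hsymm _ (hend q hq)))
  rwa [conj_base] at hM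

end Attach

end Shortcut

namespace Shortcut

open Set Metric Topology

namespace Attach

/-! ### Compact sets and attached cells. -/

section Compactness

variable {n : ℕ} {Y : Type u} [TopologicalSpace Y] {B : Type u} {φ : B → AttachingMap n Y}

lemma isClosed_range_base : IsClosed (range (base : Y → Attach φ)) := by
  refine isClosed_iff.2 ⟨by simp, fun b => ?_⟩
  have : char φ b ⁻¹' range base = (ball 0 1)ᶜ := by
    ext x
    rcases lt_or_ge ‖x‖ 1 with h | h
    · simp [char_of_norm_lt h, h]
    · simp [char_of_le_norm h, h]
  rw [this]
  exact isOpen_ball.isClosed_compl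

/-- A compact set meets only finitely many of the attached cells. -/
lemma finite_cells_of_isCompact {K : Set (Attach φ)} (hK : IsCompact K) :
    {b | ∃ x, cell b x ∈ K}.Finite := by
  set I := {b | ∃ x, cell b x ∈ K}
  rcases I.eq_empty_or_nonempty with hI | ⟨b₀, hb₀⟩
  · rw [hI]; exact finite_empty
  choose x hx using fun b : I => b.2
  let S : I → Attach φ := fun b => cell b (x b)
  -- One point is chosen in each cell met by `K`. Any set of chosen points is closed, as its
  -- preimage under each characteristic map has at most one element.
  have hclosed : ∀ J : Set I, IsClosed (S '' J) := by
    refine fun J => isClosed_iff.2 ⟨?_, fun b => ?_⟩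
    · have : base ⁻¹' (S '' J) = ∅ := by ext y; simp [S]
      rw [this]; exact isClosed_empty
    · refine Subsingleton.isClosed ?_
      have key : ∀ y, char φ b y ∈ S '' J → ∃ hb : b ∈ I, y = x ⟨b, hb⟩ := by
        rintro y ⟨b', -, hy⟩
        rcases lt_or_ge ‖y‖ 1 with h | h
        · rw [char_of_norm_lt h] at hy
          injection hy with h1 h2
          subst h1
          exact ⟨b'.2, congrArg Subtype.val h2.symm⟩
        · rw [char_of_le_norm h] at hy
          cases hy
      intro y hy z hz
      obtain ⟨_, rfl⟩ := key y hy
      obtain ⟨_, rfl⟩ := key z hz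
      rfl
  -- The member of the cover indexed by `b` omits all chosen points except the one in `b`, so a
  -- finite subcover leaves finitely many cells.
  obtain ⟨t, ht⟩ := hK.elim_finite_subcover (fun b : I => (S '' {b}ᶜ)ᶜ)
    (fun b => (hclosed _).isOpen_compl) (by
      intro p _
      by_cases hp : p ∈ range S
      · obtain ⟨b, rfl⟩ := hp
        refine mem_iUnion.2 ⟨b, ?_⟩
        rintro ⟨b', hb', h⟩
        injection h with h1 _
        exact hb' (Subtype.ext h1)
      · exact mem_iUnion.2 ⟨⟨b₀, hb₀⟩, fun h => hp (image_subset_range _ _ h)⟩)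
  refine (t.finite_toSet.image Subtype.val).subset fun b hb => ?_
  obtain ⟨b', hb', h⟩ := mem_iUnion₂.1 (ht (hx ⟨b, hb⟩))
  refine ⟨b', hb', ?_⟩
  by_contra hne
  exact h ⟨⟨b, hb⟩, fun e => hne (congrArg Subtype.val e).symm, rfl⟩

lemma finite_base_of_isCompact [DiscreteTopology Y] {K : Set (Attach φ)} (hK : IsCompact K) :
    (base ⁻¹' K).Finite :=
  ((IsClosedEmbedding.mk isEmbedding_base isClosed_range_base).isCompact_preimage
    hK).finite_of_discrete

end Compactness

end Attach

section TwoComplex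

/-! ### Two-dimensional complexes -/

variable {V A : Type u} [TopologicalSpace V]

/-- The attaching map of an edge with given ends. -/
noncomputable def edgeMap (src tgt : A → V) (a : A) : AttachingMap 1 V where
  toFun x := if x 0 < 0 then src a else tgt a
  continuousOn x hx := by
    refine ContinuousAt.continuousWithinAt ?_
    have h0 : x 0 ≠ 0 := fun h => hx (funext fun i => by rw [Subsingleton.elim i 0, h]; rfl)
    have hc : ContinuousAt (fun y : Fin 1 → ℝ => y 0) x := (continuous_apply 0).continuousAt
    rcases h0.lt_or_gt with h | h
    · refine (continuousAt_const (y := src a)).congr ?_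
      filter_upwards [hc.eventually_lt_const h] with y hy
      rw [if_pos hy]
    · refine (continuousAt_const (y := tgt a)).congr ?_
      filter_upwards [hc.eventually_const_lt h] with y hy
      rw [if_neg hy.not_gt]
  smul_eq c x hc := by simp [mul_neg_iff, hc, hc.not_gt]

/-- The one-dimensional complex with given edges. -/
abbrev Skel (src tgt : A → V) := Attach (edgeMap src tgt)

variable {src tgt : A → V} {B : Type u} (ψ : B → AttachingMap 2 (Skel src tgt))

/-- The cells of a two-dimensional complex. -/
def Cells (V A B : Type u) : ℕ → Type u
  | 0 => V
  | 1 => A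
  | 2 => B
  | _ + 3 => PEmpty

/-- A vertex as a zero-dimensional cell. -/
def vertexEquiv (v : V) : PartialEquiv (Fin 0 → ℝ) (Attach ψ) where
  toFun _ := .base (.base v)
  invFun _ := 0
  source := ball 0 1
  target := {.base (.base v)}
  map_source' _ _ := rfl
  map_target' _ _ := by simp
  left_inv' _ _ := Subsingleton.elim _ _
  right_inv' _ h := h.symm

/-- An edge as a one-dimensional cell. -/
noncomputable def edgeEquiv (a : A) : PartialEquiv (Fin 1 → ℝ) (Attach ψ) where
  toFun x := .base (Attach.char (edgeMap src tgt) a x)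
  invFun p := Attach.coord a p.ret
  source := ball 0 1
  target := (fun x => .base (Attach.char (edgeMap src tgt) a x)) '' ball 0 1
  map_source' x hx := ⟨x, hx, rfl⟩
  map_target' := by
    rintro _ ⟨x, hx, rfl⟩
    rw [Attach.ret, Attach.coord_char (by simpa using hx)]
    exact hx
  left_inv' x hx := by rw [Attach.ret, Attach.coord_char (by simpa using hx)]
  right_inv' := by
    rintro _ ⟨x, hx, rfl⟩
    rw [Attach.ret, Attach.coord_char (by simpa using hx)]

/-- The characteristic maps of the cells of a two-dimensional complex. -/
noncomputable def cellEquiv : ∀ n, Cells V A B n → PartialEquiv (Fin n → ℝ) (Attach ψ)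
  | 0, v => vertexEquiv ψ v
  | 1, a => edgeEquiv ψ a
  | 2, b => Attach.charEquiv ψ b
  | _ + 3, c => c.elim

/-- The open cell which contains a point. -/
def carrier : Attach ψ → Σ n, Cells V A B n
  | .base (.base v) => ⟨0, v⟩
  | .base (.cell a _) => ⟨1, a⟩
  | .cell b _ => ⟨2, b⟩

lemma carrier_char_base (a : A) {x : Fin 1 → ℝ} (hx : x ∈ ball 0 1) :
    carrier ψ (.base (Attach.char (edgeMap src tgt) a x)) = ⟨1, a⟩ := by
  rw [Attach.char_of_norm_lt (by simpa using hx)]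
  rfl

lemma carrier_char (b : B) {x : Fin 2 → ℝ} (hx : x ∈ ball 0 1) :
    carrier ψ (Attach.char ψ b x) = ⟨2, b⟩ := by
  rw [Attach.char_of_norm_lt (by simpa using hx)]
  rfl

lemma carrier_cellEquiv : ∀ (n : ℕ) (c : Cells V A B n) (x : Fin n → ℝ), x ∈ ball 0 1 →
    carrier ψ (cellEquiv ψ n c x) = ⟨n, c⟩
  | 0, _, _, _ => rfl
  | 1, a, _, hx => carrier_char_base ψ a hx
  | 2, b, _, hx => carrier_char ψ b hx
  | _ + 3, c, _, _ => c.elim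

lemma exists_eq_cellEquiv (p : Attach ψ) :
    ∃ (n : ℕ) (c : Cells V A B n) (x : Fin n → ℝ), x ∈ ball 0 1 ∧ cellEquiv ψ n c x = p := by
  match p with
  | .base (.base v) => exact ⟨0, v, 0, by simp, rfl⟩
  | .base (.cell a x) => exact ⟨1, a, x, x.2, congrArg _ (Attach.char_coe a x)⟩
  | .cell b x => exact ⟨2, b, x, x.2, Attach.char_coe b x⟩

lemma continuous_cellEquiv : ∀ (n : ℕ) (c : Cells V A B n), Continuous (cellEquiv ψ n c)
  | 0, _ => continuous_const
  | 1, a => Attach.continuous_base.comp (Attach.continuous_char (φ := edgeMap src tgt) a)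
  | 2, b => Attach.continuous_char (φ := ψ) b
  | _ + 3, c => c.elim

lemma continuousOn_edgeEquiv_symm (a : A) :
    ContinuousOn (edgeEquiv ψ a).symm (edgeEquiv ψ a).target := by
  refine (Attach.continuousOn_coord a).comp (Attach.continuousOn_ret.mono ?_) ?_
  · rintro _ ⟨x, -, rfl⟩
    exact mem_univ (Attach.char (edgeMap src tgt) a x)
  · rintro _ ⟨x, hx, rfl⟩
    exact ⟨x, hx, rfl⟩

lemma continuousOn_cellEquiv_symm : ∀ (n : ℕ) (c : Cells V A B n),
    ContinuousOn (cellEquiv ψ n c).symm (cellEquiv ψ n c).target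
  | 0, _ => continuousOn_const
  | 1, a => continuousOn_edgeEquiv_symm ψ a
  | 2, b => Attach.continuousOn_coord b
  | _ + 3, c => c.elim

lemma edgeMap_eq_or (a : A) (x : Fin 1 → ℝ) :
    edgeMap src tgt a x = src a ∨ edgeMap src tgt a x = tgt a := by
  change (if x 0 < 0 then src a else tgt a) = _ ∨ (if x 0 < 0 then src a else tgt a) = _
  split_ifs <;> simp

lemma char_edgeMap_neg_one (src tgt : A → V) (a : A) :
    Attach.char (edgeMap src tgt) a (fun _ => -1) = .base (src a) := by
  have h : edgeMap src tgt a (fun _ => -1) = src a := if_pos (by norm_num)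
  rw [Attach.char_of_le_norm (by simp), h]

lemma char_edgeMap_one (src tgt : A → V) (a : A) :
    Attach.char (edgeMap src tgt) a (fun _ => 1) = .base (tgt a) := by
  have h : edgeMap src tgt a (fun _ => 1) = tgt a := if_neg (by norm_num)
  rw [Attach.char_of_le_norm (by simp), h]

lemma image_edge_sphere (a : A) :
    (fun x => (.base (Attach.char (edgeMap src tgt) a x) : Attach ψ)) '' sphere 0 1 =
      {.base (.base (src a)), .base (.base (tgt a))} := by
  refine subset_antisymm ?_ ?_
  · rintro _ ⟨x, hx, rfl⟩
    have h1 : ‖x‖ = 1 := by simpa using hx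
    simp only [Attach.char_of_le_norm h1.ge]
    rcases edgeMap_eq_or (src := src) (tgt := tgt) a x with h | h <;> simp [h]
  · rintro _ (rfl | rfl)
    · exact ⟨fun _ => -1, by simp, congrArg _ (char_edgeMap_neg_one src tgt a)⟩
    · exact ⟨fun _ => 1, by simp, congrArg _ (char_edgeMap_one src tgt a)⟩

/-- A finite family of cells of dimension at most one. -/
def cellFamily (I₀ : Finset V) (I₁ : Finset A) : Π m, Finset (Cells V A B m)
  | 0 => I₀
  | 1 => I₁
  | _ + 2 => ∅

lemma base_base_mem (I₀ : Finset V) (I₁ : Finset A) {n : ℕ} (hn : 0 < n) {v : V} (hv : v ∈ I₀) :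
    (.base (.base v) : Attach ψ) ∈
      ⋃ (m < n) (j ∈ cellFamily (B := B) I₀ I₁ m), cellEquiv ψ m j '' closedBall 0 1 :=
  mem_iUnion₂.2 ⟨0, hn, mem_iUnion₂.2 ⟨v, hv, 0, by simp, rfl⟩⟩

lemma base_cell_mem (I₀ : Finset V) (I₁ : Finset A) {n : ℕ} (hn : 1 < n) {a : A} (ha : a ∈ I₁)
    (x : ball (0 : Fin 1 → ℝ) 1) : (.base (.cell a x) : Attach ψ) ∈
      ⋃ (m < n) (j ∈ cellFamily (B := B) I₀ I₁ m), cellEquiv ψ m j '' closedBall 0 1 :=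
  mem_iUnion₂.2 ⟨1, hn, mem_iUnion₂.2 ⟨a, ha, x, ball_subset_closedBall x.2,
    congrArg _ (Attach.char_coe a x)⟩⟩

open Classical in
lemma mapsTo_edge (a : A) : ∃ I : Π m, Finset (Cells V A B m),
    MapsTo (edgeEquiv ψ a) (sphere 0 1)
      (⋃ (m < 1) (j ∈ I m), cellEquiv ψ m j '' closedBall 0 1) := by
  refine ⟨cellFamily {src a, tgt a} ∅, fun x hx => ?_⟩
  rcases (image_edge_sphere ψ a).subset ⟨x, hx, rfl⟩ with h | h
  · exact Set.mem_of_eq_of_mem h (base_base_mem ψ _ _ one_pos (by simp))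
  · exact Set.mem_of_eq_of_mem h (base_base_mem ψ _ _ one_pos (by simp))

variable [DiscreteTopology V]

/-- Closure finiteness: the boundary of the cell has compact image, which meets finitely many
vertices and open edges. -/
lemma mapsTo_char (b : B) : ∃ I : Π m, Finset (Cells V A B m),
    MapsTo (Attach.char ψ b) (sphere 0 1)
      (⋃ (m < 2) (j ∈ I m), cellEquiv ψ m j '' closedBall 0 1) := by
  have hK : IsCompact (ψ b '' sphere 0 1) := (isCompact_sphere _ _).image_of_continuousOn
    ((ψ b).continuousOn.mono fun x hx => Attach.ne_zero_of_le_norm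
      (mem_sphere_zero_iff_norm.1 hx).ge)
  refine ⟨cellFamily (Attach.finite_base_of_isCompact hK).toFinset
    (Attach.finite_cells_of_isCompact hK).toFinset, fun x hx => ?_⟩
  have hx' : ψ b x ∈ ψ b '' sphere 0 1 := ⟨x, hx, rfl⟩
  rw [Attach.char_of_le_norm (mem_sphere_zero_iff_norm.1 hx).ge]
  generalize ψ b x = p at hx'
  cases p with
  | base v =>
    exact base_base_mem ψ _ _ two_pos ((Attach.finite_base_of_isCompact hK).mem_toFinset.2 hx')
  | cell a z =>
    exact base_cell_mem ψ _ _ one_lt_two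
      ((Attach.finite_cells_of_isCompact hK).mem_toFinset.2 ⟨z, hx'⟩) z

lemma mapsTo_cellEquiv : ∀ (n : ℕ) (c : Cells V A B n), ∃ I : Π m, Finset (Cells V A B m),
    MapsTo (cellEquiv ψ n c) (sphere 0 1)
      (⋃ (m < n) (j ∈ I m), cellEquiv ψ m j '' closedBall 0 1)
  | 0, _ => ⟨fun _ => ∅, fun x hx => by
      rw [mem_sphere_zero_iff_norm, Subsingleton.elim x 0, norm_zero] at hx
      exact (zero_ne_one hx).elim⟩
  | 1, a => mapsTo_edge ψ a
  | 2, b => mapsTo_char ψ b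
  | _ + 3, c => c.elim

/-- The cell structure of a two-dimensional complex. -/
noncomputable instance cwComplex : CWComplex (univ : Set (Attach ψ)) where
  cell := Cells V A B
  map := cellEquiv ψ
  source_eq n c := match n, c with
    | 0, _ => rfl
    | 1, _ => rfl
    | 2, _ => rfl
    | _ + 3, c => c.elim
  continuousOn n c := (continuous_cellEquiv ψ n c).continuousOn
  continuousOn_symm := continuousOn_cellEquiv_symm ψ
  pairwiseDisjoint' := by
    rintro ⟨n, c⟩ - ⟨m, d⟩ - hne
    refine Set.disjoint_left.2 ?_
    rintro _ ⟨x, hx, rfl⟩ ⟨y, hy, h⟩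
    apply hne
    rw [← carrier_cellEquiv ψ n c x hx, ← carrier_cellEquiv ψ m d y hy]
    exact congrArg _ h.symm
  mapsTo' := mapsTo_cellEquiv ψ
  closed' S _ h := by
    refine Attach.isClosed_of_inter_closedCell
      (Attach.isClosed_of_inter_closedCell (isClosed_discrete _) fun a => ?_) fun b => h 2 b
    have := (h 1 a).preimage Attach.continuous_base
    convert this using 1
    ext p
    refine and_congr_right fun _ => ⟨?_, ?_⟩
    · rintro ⟨x, hx, rfl⟩
      exact ⟨x, hx, rfl⟩
    · rintro ⟨x, hx, h⟩
      exact ⟨x, hx, Attach.base_injective h⟩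
  union' := by
    refine eq_univ_of_forall fun p => ?_
    obtain ⟨n, c, x, hx, rfl⟩ := exists_eq_cellEquiv ψ p
    exact mem_iUnion₂.2 ⟨n, c, x, ball_subset_closedBall hx, rfl⟩

lemma isCompactTwoComplex [Finite V] [Finite A] [Finite B] : IsCompactTwoComplex (Attach ψ) where
  t2 := inferInstance
  compact :=
    have : CompactSpace (Skel src tgt) := Attach.compactSpace
    Attach.compactSpace
  dim_le_two n hn := match n, hn with
    | _ + 3, _ => inferInstanceAs (IsEmpty PEmpty)

lemma isLink_iff (a : A) (x y : V) :
    (CWComplex.OneSkeletonGraph (univ : Set (Attach ψ))).IsLink (α := V) (β := A) a x y ↔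
      src a = x ∧ tgt a = y ∨ src a = y ∧ tgt a = x := by
  refine (CWComplex.OneSkeletonGraph.isLink_iff_pair (C := (univ : Set (Attach ψ))) a x y).trans ?_
  change ((fun x => (.base (Attach.char (edgeMap src tgt) a x) : Attach ψ)) '' sphere 0 1 =
    {.base (.base x), .base (.base y)}) ↔ _
  rw [image_edge_sphere, pair_eq_pair_iff]
  simp

variable {Γ : SimpleGraph V}

lemma oneSkeletonGraph_simple
    (hadj : ∀ x y, Γ.Adj x y ↔ ∃ a, src a = x ∧ tgt a = y ∨ src a = y ∧ tgt a = x)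
    (heq : ∀ a a', src a = src a' ∧ tgt a = tgt a' ∨ src a = tgt a' ∧ tgt a = src a' → a = a') :
    (CWComplex.OneSkeletonGraph (univ : Set (Attach ψ))).Simple where
  not_isLoopAt a x h := Γ.irrefl ((hadj x x).2 ⟨a, (isLink_iff ψ a x x).1 h⟩)
  eq_of_isLink a a' x y h h' := by
    refine heq a a' ?_
    rcases (isLink_iff ψ a x y).1 h with ⟨h1, h2⟩ | ⟨h1, h2⟩ <;>
      rcases (isLink_iff ψ a' x y).1 h' with ⟨h3, h4⟩ | ⟨h3, h4⟩ <;>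
      grind

/-- The one-skeleton of a two-dimensional complex. -/
def oneSkeletonIso
    (hadj : ∀ x y, Γ.Adj x y ↔ ∃ a, src a = x ∧ tgt a = y ∨ src a = y ∧ tgt a = x) :
    Γ ≃g (CWComplex.OneSkeletonGraph (univ : Set (Attach ψ))).toSimpleGraph where
  toFun v := ⟨v, mem_univ _⟩
  invFun v := v.1
  map_rel_iff' {x y} := by
    refine Iff.trans ?_ (hadj x y).symm
    refine ⟨fun h => ?_, fun h => ⟨fun e => ?_, ?_⟩⟩
    · obtain ⟨a, ha⟩ := h.2
      exact ⟨a, (isLink_iff ψ a x y).1 ha⟩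
    · exact ((hadj x y).2 h).ne (congrArg Subtype.val e)
    · obtain ⟨a, ha⟩ := h
      exact ⟨a, (isLink_iff ψ a x y).2 ha⟩

end TwoComplex

end Shortcut

namespace Shortcut

open Set Metric Topology
open scoped unitInterval

/-! ### Deforming paths off cells of dimension at least two. -/

namespace Attach

variable {n : ℕ} {Y : Type u} [TopologicalSpace Y] {B : Type u} {φ : B → AttachingMap n Y}

/-- The path classes which are represented by paths in the base. -/
inductive IsBaseClass : ∀ {p q : Attach φ}, Path.Homotopic.Quotient p q → Prop
  | mk {y y' : Y} (δ : Path y y') : IsBaseClass (.mk (δ.map continuous_base))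

/-- Paths between points of the base can be deformed into the base if the cells have dimension at
least two. -/
theorem exists_eq_mk_map_base (hn : 2 ≤ n) {y y' : Y}
    (γ : Path.Homotopic.Quotient (base y : Attach φ) (base y')) :
    ∃ δ : Path y y', γ = .mk (δ.map continuous_base) := by
  have hrank : 1 < Module.rank ℝ (Fin n → ℝ) := by
    rw [rank_fin_fun]
    exact_mod_cast hn
  have : Nonempty (Fin n) := ⟨⟨0, by omega⟩⟩
  have hp₀ : ‖(fun _ => 1 : Fin n → ℝ)‖ = 1 := by simp
  have key : IsBaseClass γ := by
    refine path_induction IsBaseClass (fun y => .mk (Path.refl y)) ?_ ?_ .mk hp₀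
      (fun b z hz => ?_) γ
    · rintro p q r _ _ ⟨γ⟩ ⟨δ⟩
      rw [← Path.Homotopic.Quotient.mk_trans, ← Path.map_trans]
      exact .mk _
    · rintro p q _ ⟨γ⟩
      rw [← Path.Homotopic.Quotient.mk_symm, Path.map_symm]
      exact .mk _
    -- In dimension at least two the boundary sphere is path connected, so a segment across the cell
    -- is homotopic to a path along the boundary, which maps into the base.
    · have hj := (isPathConnected_sphere hrank (0 : Fin n → ℝ) zero_le_one).joinedIn _
        (mem_sphere_zero_iff_norm.2 hp₀) _ (mem_sphere_zero_iff_norm.2 hz)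
      have hmem : ∀ t, ‖hj.somePath t‖ = 1 := fun t => mem_sphere_zero_iff_norm.1
          (hj.somePath_mem t)
      let δ : Path (φ b fun _ => 1) (φ b z) :=
        ⟨⟨fun t => φ b (hj.somePath t), (φ b).continuousOn.comp_continuous hj.somePath.continuous
          fun t => ne_zero_of_le_norm (hmem t).ge⟩, by simp, by simp⟩
      rw [← mk_eq_mk_diskPath _ _ (δ.map continuous_base) hj.somePath
        fun t => (char_of_le_norm (hmem t).ge).symm]
      exact .mk δ
  obtain ⟨δ⟩ := key
  exact ⟨δ, rfl⟩

end Attach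

/-! ### Attaching two-cells along loops. -/

section Loops

/-- The loop on the circle which runs along the boundary of the square. -/
noncomputable def squareLoop (t : ℝ) : Fin 2 → ℝ :=
  ![2 * Real.cos (2 * Real.pi * t), 2 * Real.sin (2 * Real.pi * t)]

lemma continuous_squareLoop : Continuous squareLoop := by
  refine continuous_pi fun i => ?_
  fin_cases i
  · exact (by fun_prop : Continuous fun t : ℝ => 2 * Real.cos (2 * Real.pi * t))
  · exact (by fun_prop : Continuous fun t : ℝ => 2 * Real.sin (2 * Real.pi * t))

/-- The norm is the supremum norm, so the circle of radius 2 avoids the open unit cube; there the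
characteristic map agrees with the attaching map. -/
lemma one_le_norm_squareLoop (t : ℝ) : 1 ≤ ‖squareLoop t‖ := by
  have h0 : |2 * Real.cos (2 * Real.pi * t)| ≤ ‖squareLoop t‖ := norm_le_pi_norm (squareLoop t) 0
  have h1 : |2 * Real.sin (2 * Real.pi * t)| ≤ ‖squareLoop t‖ := norm_le_pi_norm (squareLoop t) 1
  by_contra! h
  have h2 := abs_lt.1 (h0.trans_lt h)
  have h3 := abs_lt.1 (h1.trans_lt h)
  nlinarith [Real.cos_sq_add_sin_sq (2 * Real.pi * t)]

/-- A point of the plane as a complex number. -/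
noncomputable def toComplex (x : Fin 2 → ℝ) : ℂ := x 0 + x 1 * Complex.I

lemma toComplex_ne_zero {x : Fin 2 → ℝ} (hx : x ≠ 0) : toComplex x ≠ 0 := by
  intro h
  have h0 := congrArg Complex.re h
  have h1 := congrArg Complex.im h
  simp only [toComplex, Complex.add_re, Complex.add_im, Complex.ofReal_re, Complex.ofReal_im,
    Complex.mul_re, Complex.mul_im, Complex.I_re, Complex.I_im, Complex.zero_re, Complex.zero_im,
    mul_zero, mul_one, zero_add, add_zero, sub_zero] at h0 h1
  exact hx (funext fun i => by fin_cases i <;> assumption)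

lemma arg_squareLoop (t : ℝ) :
    ((toComplex (squareLoop t)).arg : Real.Angle) = (2 * Real.pi * t : ℝ) := by
  have : toComplex (squareLoop t) = (2 : ℝ) * (Real.Angle.cos ((2 * Real.pi * t : ℝ) : Real.Angle) +
      Real.Angle.sin ((2 * Real.pi * t : ℝ) : Real.Angle) * Complex.I) := by
    simp [toComplex, squareLoop]
    ring
  rw [this, Complex.arg_real_mul _ two_pos, Complex.arg_cos_add_sin_mul_I_coe_angle]

local instance : Fact (0 < 2 * Real.pi) := ⟨Real.two_pi_pos⟩

variable {Y : Type*} [TopologicalSpace Y] {y : Y}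

/-- A loop as a map on the circle. -/
noncomputable def circleMap (γ : Path y y) : AddCircle (2 * Real.pi) → Y :=
  AddCircle.liftIco (2 * Real.pi) 0 fun s => γ.extend (s / (2 * Real.pi))

lemma continuous_circleMap (γ : Path y y) : Continuous (circleMap γ) := by
  refine AddCircle.liftIco_continuous ?_ (Continuous.continuousOn (by fun_prop))
  simp

lemma circleMap_coe (γ : Path y y) (t : I) :
    circleMap γ ((2 * Real.pi * t : ℝ) : AddCircle (2 * Real.pi)) = γ t := by
  have hpi := Real.two_pi_pos
  -- The lift is defined on a half-open interval, so the end `t = 1` is treated through its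
  -- identification with 0.
  rcases eq_or_lt_of_le t.2.2 with h | h
  · have h1 : ((2 * Real.pi * t : ℝ) : AddCircle (2 * Real.pi)) = ((0 : ℝ) : AddCircle _) := by
      rw [h, mul_one, AddCircle.coe_period]; rfl
    rw [h1, circleMap, AddCircle.liftIco_coe_apply (by simp [hpi])]
    obtain rfl : t = 1 := Subtype.ext h
    simp
  · rw [circleMap, AddCircle.liftIco_coe_apply ⟨mul_nonneg hpi.le t.2.1, by nlinarith⟩,
      mul_div_cancel_left₀ _ hpi.ne', Path.extend_apply _ t.2]

/-- The attaching map of a two-cell along a loop. -/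
noncomputable def loopAttach (γ : Path y y) : AttachingMap 2 Y where
  toFun x := circleMap γ ((toComplex x).arg : Real.Angle)
  continuousOn x hx := by
    refine (((continuous_circleMap γ).continuousAt).comp (ContinuousAt.comp (f := toComplex)
      (Complex.continuousAt_arg_coe_angle (toComplex_ne_zero hx)) ?_)).continuousWithinAt
    unfold toComplex
    fun_prop
  smul_eq c x hc := by
    have : toComplex (c • x) = (c : ℂ) * toComplex x := by
      simp [toComplex]
      ring
    rw [this, Complex.arg_real_mul _ hc]

lemma loopAttach_squareLoop (γ : Path y y) (t : I) : loopAttach γ (squareLoop t) = γ t := by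
  change circleMap γ ((toComplex (squareLoop t)).arg : Real.Angle) = γ t
  rw [arg_squareLoop]
  exact circleMap_coe γ t

/-- The attaching map composed with a map. -/
def AttachingMap.comp {n : ℕ} {Y Y' : Type*} [TopologicalSpace Y] [TopologicalSpace Y']
    (φ : AttachingMap n Y) (f : Y → Y') (hf : Continuous f) : AttachingMap n Y' where
  toFun x := f (φ x)
  continuousOn := hf.comp_continuousOn φ.continuousOn
  smul_eq c x hc := congrArg f (φ.smul_eq c x hc)

/-- A loop along which a two-cell is attached is null-homotopic. -/
lemma Attach.mk_map_base_eq_refl {Y : Type u} [TopologicalSpace Y] {B : Type u}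
    {φ : B → AttachingMap 2 Y} {b : B} {y : Y} (γ : Path y y)
    (h : ∀ t : I, φ b (squareLoop t) = γ t) :
    Path.Homotopic.Quotient.mk (γ.map (continuous_base (φ := φ))) =
      Path.Homotopic.Quotient.refl (base y) := by
  have hend : squareLoop 1 = squareLoop 0 := by simp [squareLoop]
  let δ : Path (squareLoop 0) (squareLoop 0) :=
    ⟨⟨fun t => squareLoop t, continuous_squareLoop.comp continuous_subtype_val⟩, by simp,
      by simpa using hend⟩
  have hb : ∀ t : I, base (γ t) = char φ b (squareLoop t) := fun t => by
    rw [char_of_le_norm (one_le_norm_squareLoop t), h]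
  refine Path.Homotopic.Quotient.eq.2 (homotopic_of_factor ⟨char φ b, continuous_char b⟩ δ
    (Path.refl _) hb fun t => ?_)
  simpa using hb 0

end Loops

/-! ### Coverings obtained by attaching cells equivariantly. -/

section Equivariant

namespace Attach

variable {n : ℕ} {Y Y' B : Type u} [TopologicalSpace Y] [TopologicalSpace Y']

section Map

variable {G : Type u} {φ : FreeSet G B → AttachingMap n Y}

/-- The map of spaces with attached cells which forgets the group element labelling a cell. -/
def map (φ' : B → AttachingMap n Y') (f : Y → Y') : Attach φ → Attach φ'
  | base y => base (f y)
  | cell c x => cell c.orb x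

variable {φ' : B → AttachingMap n Y'} {f : Y → Y'}

lemma map_char (h : ∀ c x, φ' c.orb x = f (φ c x)) (c : FreeSet G B) (x : Fin n → ℝ) :
    map φ' f (char φ c x) = char φ' c.orb x := by
  rcases lt_or_ge ‖x‖ 1 with hx | hx
  · rw [char_of_norm_lt hx, char_of_norm_lt hx]; rfl
  · rw [char_of_le_norm hx, char_of_le_norm hx, h]; rfl

end Map

variable {G : Type u} [Group G] [MulAction G Y] {φ : FreeSet G B → AttachingMap n Y}

instance : MulAction G (Attach φ) where
  smul k
    | base y => base (k • y)
    | cell c x => cell (k • c) x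
  one_smul
    | base y => congrArg base (one_smul G y)
    | cell c x => congrArg (cell · x) (one_smul G c)
  mul_smul k l
    | base y => congrArg base (mul_smul k l y)
    | cell c x => congrArg (cell · x) (mul_smul k l c)

lemma smul_char (h : ∀ (k : G) c x, φ (k • c) x = k • φ c x) (k : G) (c : FreeSet G B)
    (x : Fin n → ℝ) : k • char φ c x = char φ (k • c) x := by
  rcases lt_or_ge ‖x‖ 1 with hx | hx
  · rw [char_of_norm_lt hx, char_of_norm_lt hx]; rfl
  · rw [char_of_le_norm hx, char_of_le_norm hx, h]; rfl

/-- Attaching cells equivariantly to a regular covering space gives a regular covering space. -/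
theorem isQuotientCoveringMap_map {φ' : B → AttachingMap n Y'} {f : Y → Y'}
    (hf : IsQuotientCoveringMap f G) (hφ : ∀ (k : G) c x, φ (k • c) x = k • φ c x)
    (hφ' : ∀ c x, φ' c.orb x = f (φ c x)) : IsQuotientCoveringMap (map (φ := φ) φ' f) G where
  surjective
    | base y => by
      obtain ⟨z, rfl⟩ := hf.surjective y
      exact ⟨base z, rfl⟩
    | cell b x => ⟨cell ⟨1, b⟩ x, rfl⟩
  eq_coinduced := by
    refine TopologicalSpace.ext_iff.2 fun U => ?_
    have hb : base ⁻¹' (map (φ := φ) φ' f ⁻¹' U) = f ⁻¹' (base ⁻¹' U) := rfl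
    have hc : ∀ c, char φ c ⁻¹' (map φ' f ⁻¹' U) = char φ' c.orb ⁻¹' U := fun c => by
      ext x
      rw [mem_preimage, mem_preimage, map_char hφ', mem_preimage]
    rw [isOpen_coinduced, isOpen_iff, isOpen_iff, hb, ← hf.isOpen_preimage]
    simp only [hc]
    exact and_congr_right fun _ => ⟨fun h c => h c.orb, fun h b => h ⟨1, b⟩⟩
  continuous_const_smul k := by
    refine continuous_iff.2 ⟨continuous_base.comp (hf.continuous_const_smul k), fun c => ?_⟩
    have : (k • ·) ∘ char φ c = char φ (k • c) := funext fun x => smul_char hφ k c x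
    rw [this]
    exact continuous_char _
  apply_eq_iff_mem_orbit {p q} := by
    match p, q with
    | base y, base y' =>
      refine Iff.trans ⟨fun h => base_injective h, congrArg base⟩
        (hf.apply_eq_iff_mem_orbit.trans ?_)
      exact ⟨fun ⟨k, h⟩ => ⟨k, congrArg base h⟩, fun ⟨k, h⟩ => ⟨k, base_injective h⟩⟩
    | base y, cell c x => exact iff_of_false (fun h => by cases h) (by rintro ⟨k, ⟨⟩⟩)
    | cell c x, base y => exact iff_of_false (fun h => by cases h) (by rintro ⟨k, ⟨⟩⟩)
    | cell c x, cell c' x' =>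
      constructor
      · intro h
        have h' : (cell c.orb x : Attach φ') = cell c'.orb x' := h
        injection h' with h1 h2
        subst h2
        refine ⟨c.elt * c'.elt⁻¹, congrArg (cell · x) (FreeSet.ext ?_ h1.symm)⟩
        simp
      · rintro ⟨k, h⟩
        have h' : (cell (k • c') x' : Attach φ) = cell c x := h
        injection h' with h1 h2
        subst h1 h2
        rfl
  disjoint
    | base y => by
      obtain ⟨U, hU, h⟩ := hf.disjoint y
      obtain ⟨W, hWU, hW, hy⟩ := mem_nhds_iff.1 hU
      refine ⟨thicken φ W, (isOpen_thicken hW).mem_nhds hy, fun k => ?_⟩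
      rintro ⟨_, ⟨p, hp, rfl⟩, hp'⟩
      refine h k ?_
      cases p with
      | base z => exact ⟨k • z, ⟨z, hWU hp, rfl⟩, hWU hp'⟩
      | cell c x =>
        have h' : φ (k • c) x ∈ W := hp'.2
        rw [hφ] at h'
        exact ⟨k • φ c x, ⟨_, hWU hp.2, rfl⟩, hWU h'⟩
    | cell c x => by
      -- The whole open cell serves as the neighbourhood: a translate meeting it is the same cell,
      -- and the action on cell labels is free.
      refine ⟨_, (isOpen_cell_image isOpen_univ c).mem_nhds ⟨x, mem_univ _, rfl⟩, fun k => ?_⟩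
      rintro ⟨_, ⟨_, ⟨z, -, rfl⟩, rfl⟩, ⟨z', -, h⟩⟩
      have h' : (cell c z' : Attach φ) = cell (k • c) z := h
      injection h' with h1 _
      have := congrArg FreeSet.elt h1
      simpa using this.symm

end Attach

end Equivariant

end Shortcut

namespace Shortcut

open Set Metric Topology
open scoped unitInterval

section Presentation

/-! ### The complex of a graph with a free action -/

variable {G : Type u} {T : Type u}

instance : TopologicalSpace (FreeSet G T) := ⊥

instance : DiscreteTopology (FreeSet G T) := ⟨rfl⟩

variable [Group G]

lemma FreeSet.isQuotientCoveringMap_orb [TopologicalSpace T] [DiscreteTopology T] :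
    IsQuotientCoveringMap (FreeSet.orb : FreeSet G T → T) G where
  surjective t := ⟨⟨1, t⟩, rfl⟩
  eq_coinduced := TopologicalSpace.ext_iff.2 fun U =>
    iff_of_true (isOpen_discrete _) (isOpen_coinduced.2 (isOpen_discrete _))
  continuous_const_smul _ := continuous_of_discreteTopology
  apply_eq_iff_mem_orbit {x y} := by
    constructor
    · intro h
      exact ⟨x.elt * y.elt⁻¹, FreeSet.ext (by simp) h.symm⟩
    · rintro ⟨k, rfl⟩
      rfl
  disjoint x := by
    refine ⟨{x}, (isOpen_discrete _).mem_nhds rfl, fun k => ?_⟩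
    rintro ⟨_, ⟨_, rfl, rfl⟩, h⟩
    simpa using congrArg FreeSet.elt (h : k • _ = _)

/-- A representative of an orbit of edges, oriented by the colours of its ends. -/
@[ext]
structure OrientedEdge (Δ : SimpleGraph (FreeSet G T)) (color : T → Fin 3) where
  src : T
  tgt : FreeSet G T
  adj : Δ.Adj ⟨1, src⟩ tgt
  color_lt : color src < color tgt.orb

variable {Δ : SimpleGraph (FreeSet G T)} {color : T → Fin 3}

lemma IsEquivariantGraph.finite_orientedEdge [Finite T] (hΔ : IsEquivariantGraph Δ color) :
    Finite (OrientedEdge Δ color) := by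
  have (t : T) : Finite (Δ.neighborSet ⟨1, t⟩) := (hΔ.finite_neighborSet _).to_subtype
  let F : OrientedEdge Δ color → Σ t : T, Δ.neighborSet ⟨1, t⟩ := fun e => ⟨e.src, e.tgt, e.adj⟩
  refine Finite.of_injective F fun e e' h => ?_
  obtain ⟨s, t, h1, h2⟩ := e
  obtain ⟨s', t', h1', h2'⟩ := e'
  simp only [F, Sigma.mk.injEq] at h
  obtain ⟨rfl, h⟩ := h
  simpa using congrArg Subtype.val (eq_of_heq h)

/-- The initial vertex of a translate of an oriented edge. -/
def coverSrc (c : FreeSet G (OrientedEdge Δ color)) : FreeSet G T := ⟨c.elt, c.orb.src⟩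

/-- The terminal vertex of a translate of an oriented edge. -/
def coverTgt (c : FreeSet G (OrientedEdge Δ color)) : FreeSet G T := c.elt • c.orb.tgt

variable (Δ color) in
/-- The graph as a one-dimensional complex. -/
abbrev CoverSkel := Skel (coverSrc (Δ := Δ) (color := color)) coverTgt

variable (Δ color) in
/-- The quotient of the graph as a one-dimensional complex. -/
abbrev BaseSkel [TopologicalSpace T] :=
  Skel (OrientedEdge.src (Δ := Δ) (color := color)) fun e => e.tgt.orb

lemma coverEdge_smul (k : G) (c : FreeSet G (OrientedEdge Δ color)) (x : Fin 1 → ℝ) :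
    edgeMap coverSrc coverTgt (k • c) x = k • edgeMap coverSrc coverTgt c x := by
  change (if x 0 < 0 then coverSrc (k • c) else coverTgt (k • c)) =
    k • (if x 0 < 0 then coverSrc c else coverTgt c)
  split_ifs
  · rfl
  · exact mul_smul _ _ _

variable (Δ color) in
/-- The quotient map of the graph. -/
noncomputable def skelMap [TopologicalSpace T] : CoverSkel Δ color → BaseSkel Δ color :=
  Attach.map _ FreeSet.orb

lemma orb_coverEdge [TopologicalSpace T] (c : FreeSet G (OrientedEdge Δ color)) (x : Fin 1 → ℝ) :
    edgeMap (OrientedEdge.src (Δ := Δ) (color := color)) (fun e => e.tgt.orb) c.orb x =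
      (edgeMap coverSrc coverTgt c x).orb := by
  change (if x 0 < 0 then c.orb.src else c.orb.tgt.orb) =
    (if x 0 < 0 then coverSrc c else coverTgt c).orb
  split_ifs <;> rfl

lemma isQuotientCoveringMap_skelMap [TopologicalSpace T] [DiscreteTopology T] :
    IsQuotientCoveringMap (skelMap Δ color) G :=
  Attach.isQuotientCoveringMap_map FreeSet.isQuotientCoveringMap_orb coverEdge_smul orb_coverEdge

lemma coverSkel_continuous_smul (k : G) : Continuous fun p : CoverSkel Δ color => k • p := by
  let _ : TopologicalSpace T := ⊥
  have : DiscreteTopology T := ⟨rfl⟩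
  exact (isQuotientCoveringMap_skelMap (Δ := Δ) (color := color)).continuous_const_smul k

namespace IsEquivariantGraph

/-- The cell of an edge. -/
def orientedEdge (hΔ : IsEquivariantGraph Δ color) {x y : FreeSet G T} (h : Δ.Adj x y)
    (hlt : color x.orb < color y.orb) : FreeSet G (OrientedEdge Δ color) :=
  ⟨x.elt, ⟨x.orb, x.elt⁻¹ • y, by
    have := hΔ.smul_adj x.elt⁻¹ h
    rwa [FreeSet.inv_elt_smul] at this, hlt⟩⟩

variable (hΔ : IsEquivariantGraph Δ color)

lemma coverSrc_orientedEdge {x y : FreeSet G T} (h : Δ.Adj x y)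
    (hlt : color x.orb < color y.orb) : coverSrc (hΔ.orientedEdge h hlt) = x := rfl

lemma coverTgt_orientedEdge {x y : FreeSet G T} (h : Δ.Adj x y)
    (hlt : color x.orb < color y.orb) : coverTgt (hΔ.orientedEdge h hlt) = y :=
  smul_inv_smul _ _

lemma adj_coverTgt (hΔ : IsEquivariantGraph Δ color) (c : FreeSet G (OrientedEdge Δ color)) :
    Δ.Adj (coverSrc c) (coverTgt c) := by
  have := hΔ.smul_adj c.elt c.orb.adj
  rwa [FreeSet.smul_mk, mul_one] at this

lemma orientedEdge_coverTgt (c : FreeSet G (OrientedEdge Δ color)) :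
    hΔ.orientedEdge (hΔ.adj_coverTgt c) c.orb.color_lt = c :=
  FreeSet.ext rfl (OrientedEdge.ext rfl (inv_smul_smul _ _))

lemma smul_orientedEdge (k : G) {x y : FreeSet G T} (h : Δ.Adj x y)
    (hlt : color x.orb < color y.orb) :
    hΔ.orientedEdge (hΔ.smul_adj k h) hlt = k • hΔ.orientedEdge h hlt :=
  FreeSet.ext rfl (OrientedEdge.ext rfl (by
    change (k * x.elt)⁻¹ • k • y = x.elt⁻¹ • y
    rw [mul_inv_rev, mul_smul, inv_smul_smul]))

lemma adj_iff (hΔ : IsEquivariantGraph Δ color) (x y : FreeSet G T) : Δ.Adj x y ↔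
    ∃ c : FreeSet G (OrientedEdge Δ color),
    coverSrc c = x ∧ coverTgt c = y ∨ coverSrc c = y ∧ coverTgt c = x := by
  constructor
  · intro h
    rcases (hΔ.color_ne h).lt_or_gt with hlt | hlt
    · exact ⟨_, .inl ⟨rfl, hΔ.coverTgt_orientedEdge h hlt⟩⟩
    · exact ⟨_, .inr ⟨rfl, hΔ.coverTgt_orientedEdge h.symm hlt⟩⟩
  · rintro ⟨c, ⟨rfl, rfl⟩ | ⟨rfl, rfl⟩⟩
    · exact hΔ.adj_coverTgt c
    · exact (hΔ.adj_coverTgt c).symm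

/-- Edges are oriented by increasing colour, so two of them with the same ends cannot be opposite to
each other. This makes the 1-skeleton free of multiple edges. -/
lemma eq_of_coverSrc (c c' : FreeSet G (OrientedEdge Δ color))
    (h : coverSrc c = coverSrc c' ∧ coverTgt c = coverTgt c' ∨
      coverSrc c = coverTgt c' ∧ coverTgt c = coverSrc c') : c = c' := by
  rcases h with ⟨h1, h2⟩ | ⟨h1, h2⟩
  · have he : (coverSrc c).elt = (coverSrc c').elt := congrArg _ h1
    have ho : (coverSrc c).orb = (coverSrc c').orb := congrArg _ h1
    change c.elt = c'.elt at he
    refine FreeSet.ext he (OrientedEdge.ext ho ?_)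
    rw [coverTgt, coverTgt, he] at h2
    exact smul_left_cancel _ h2
  · have h3 : color (coverSrc c).orb < color (coverTgt c).orb := c.orb.color_lt
    rw [h1, h2] at h3
    exact (h3.trans c'.orb.color_lt).false.elim

/-- The path along the edge joining two vertices. -/
noncomputable def edgePath {x y : FreeSet G T} (h : Δ.Adj x y) :
    Path (.base x : CoverSkel Δ color) (.base y) :=
  if hlt : color x.orb < color y.orb then
    Attach.diskPath (hΔ.orientedEdge h hlt) (fun _ => -1) (fun _ => 1)
      ((char_edgeMap_neg_one _ _ _).trans (congrArg _ (hΔ.coverSrc_orientedEdge h hlt)))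
      ((char_edgeMap_one _ _ _).trans (congrArg _ (hΔ.coverTgt_orientedEdge h hlt)))
  else
    (Attach.diskPath (hΔ.orientedEdge h.symm ((hΔ.color_ne h).lt_or_gt.resolve_left hlt))
      (fun _ => 1) (fun _ => -1)
      ((char_edgeMap_one _ _ _).trans (congrArg _ (hΔ.coverTgt_orientedEdge h.symm _)))
      ((char_edgeMap_neg_one _ _ _).trans (congrArg _ (hΔ.coverSrc_orientedEdge h.symm _))))

lemma smul_edgePath (k : G) {x y : FreeSet G T} (h : Δ.Adj x y) (t : I) :
    hΔ.edgePath (hΔ.smul_adj k h) t = k • hΔ.edgePath h t := by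
  by_cases hlt : color x.orb < color y.orb
  · have hlt' : color (k • x).orb < color (k • y).orb := hlt
    rw [edgePath, edgePath, dif_pos hlt, dif_pos hlt']
    refine Eq.trans ?_ (Attach.smul_char coverEdge_smul k _ _).symm
    rw [← hΔ.smul_orientedEdge]
    rfl
  · have hlt' : ¬ color (k • x).orb < color (k • y).orb := hlt
    rw [edgePath, edgePath, dif_neg hlt, dif_neg hlt']
    refine Eq.trans ?_ (Attach.smul_char coverEdge_smul k _ _).symm
    rw [← hΔ.smul_orientedEdge]
    rfl

/-- The path along a walk. -/
noncomputable def walkPath (hΔ : IsEquivariantGraph Δ color) : ∀ {x y : FreeSet G T}, Δ.Walk x y →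
    Path (.base x : CoverSkel Δ color) (.base y)
  | _, _, .nil => Path.refl _
  | _, _, .cons h w => (hΔ.edgePath h).trans (hΔ.walkPath w)

lemma smul_walkPath (k : G) {x y : FreeSet G T} (w : Δ.Walk x y) (t : I) :
    hΔ.walkPath (w.map (hΔ.smulHom k)) t = k • hΔ.walkPath w t := by
  induction w generalizing t with
  | nil => rfl
  | cons h w ih => exact trans_eq_of_factor (k • ·) _ _ (hΔ.smul_edgePath k h) ih t

lemma mk_walkPath_single {x y : FreeSet G T} (h : Δ.Adj x y) :
    Path.Homotopic.Quotient.mk (hΔ.walkPath (.cons h .nil)) = .mk (hΔ.edgePath h) :=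
  Path.Homotopic.Quotient.trans_refl (.mk (hΔ.edgePath h))

lemma mk_walkPath_append {x y z : FreeSet G T} (w : Δ.Walk x y) (w' : Δ.Walk y z) :
    Path.Homotopic.Quotient.mk (hΔ.walkPath (w.append w')) =
      (Path.Homotopic.Quotient.mk (hΔ.walkPath w)).trans (.mk (hΔ.walkPath w')) := by
  induction w with
  | nil => exact (Path.Homotopic.Quotient.refl_trans _).symm
  | cons h w ih =>
    change Path.Homotopic.Quotient.mk ((hΔ.edgePath h).trans (hΔ.walkPath (w.append w'))) =
      (Path.Homotopic.Quotient.mk ((hΔ.edgePath h).trans (hΔ.walkPath w))).trans _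
    rw [Path.Homotopic.Quotient.mk_trans, ih, Path.Homotopic.Quotient.mk_trans,
      Path.Homotopic.Quotient.trans_assoc]

lemma mk_edgePath_symm {x y : FreeSet G T} (h : Δ.Adj x y) :
    Path.Homotopic.Quotient.mk (hΔ.edgePath h.symm) =
      (Path.Homotopic.Quotient.mk (hΔ.edgePath h)).symm := by
  rcases (hΔ.color_ne h).lt_or_gt with hlt | hlt
  · rw [edgePath, edgePath, dif_pos hlt, dif_neg hlt.not_gt, Attach.diskPath_symm]
  · rw [edgePath, edgePath, dif_pos hlt, dif_neg hlt.not_gt, Attach.diskPath_symm]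

lemma mk_walkPath_reverse {x y : FreeSet G T} (w : Δ.Walk x y) :
    Path.Homotopic.Quotient.mk (hΔ.walkPath w.reverse) =
      (Path.Homotopic.Quotient.mk (hΔ.walkPath w)).symm := by
  induction w with
  | nil => exact congrArg Path.Homotopic.Quotient.mk Path.refl_symm.symm
  | cons h w ih =>
    rw [SimpleGraph.Walk.reverse_cons, mk_walkPath_append, ih]
    change _ = Path.Homotopic.Quotient.mk ((hΔ.edgePath h).trans (hΔ.walkPath w)).symm
    rw [Path.trans_symm, Path.Homotopic.Quotient.mk_trans, Path.Homotopic.Quotient.mk_symm,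
      Path.Homotopic.Quotient.mk_symm, ← mk_edgePath_symm]
    exact congrArg _ (hΔ.mk_walkPath_single h.symm)

/-- The path classes which are represented by paths along walks. -/
inductive IsWalkClass (hΔ : IsEquivariantGraph Δ color) :
    ∀ {p q : CoverSkel Δ color}, Path.Homotopic.Quotient p q → Prop
  | mk {x y : FreeSet G T} (w : Δ.Walk x y) : IsWalkClass hΔ (.mk (hΔ.walkPath w))

lemma isWalkClass_diskPath (c : FreeSet G (OrientedEdge Δ color)) {p q : CoverSkel Δ color}
    (hp : Attach.char (edgeMap coverSrc coverTgt) c (fun _ => -1) = p)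
    (hq : Attach.char (edgeMap coverSrc coverTgt) c (fun _ => 1) = q) :
    hΔ.IsWalkClass (.mk (Attach.diskPath c _ _ hp hq)) := by
  have hlt : color (coverSrc c).orb < color (coverTgt c).orb := c.orb.color_lt
  have hw := IsWalkClass.mk (hΔ := hΔ) (.cons (hΔ.adj_coverTgt c) .nil)
  obtain rfl : p = .base (coverSrc c) := hp.symm.trans (char_edgeMap_neg_one _ _ _)
  obtain rfl : q = .base (coverTgt c) := hq.symm.trans (char_edgeMap_one _ _ _)
  have h2 : hΔ.edgePath (hΔ.adj_coverTgt c) = Attach.diskPath c _ _ hp hq := by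
    rw [edgePath, dif_pos hlt]
    ext t
    change Attach.char _ (hΔ.orientedEdge _ _) _ = Attach.char _ c _
    rw [hΔ.orientedEdge_coverTgt]
  rwa [mk_walkPath_single, h2] at hw

/-- Paths between vertices are homotopic to paths along walks. -/
theorem exists_eq_mk_walkPath {x y : FreeSet G T}
    (γ : Path.Homotopic.Quotient (.base x : CoverSkel Δ color) (.base y)) :
    ∃ w : Δ.Walk x y, γ = .mk (hΔ.walkPath w) := by
  have hp₀ : ‖(fun _ => -1 : Fin 1 → ℝ)‖ = 1 := by simp
  have key : hΔ.IsWalkClass γ := by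
    refine Attach.path_induction hΔ.IsWalkClass (fun y => .mk (.nil : Δ.Walk y y)) ?_ ?_ ?_ hp₀
      (fun c z hz => ?_) γ
    · rintro p q r _ _ ⟨w⟩ ⟨w'⟩
      rw [← mk_walkPath_append]
      exact .mk _
    · rintro p q _ ⟨w⟩
      rw [← mk_walkPath_reverse]
      exact .mk _
    -- The vertex set is discrete, so a path in it is constant.
    · intro x y δ
      have hconst : ∀ t, δ t = x := fun t => by
        rw [PreconnectedSpace.constant inferInstance δ.continuous (x := t) (y := 0), δ.source]
      obtain rfl : x = y := by rw [← hconst 1, δ.target]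
      obtain rfl : δ = Path.refl x := Path.ext (funext hconst)
      exact .mk (.nil : Δ.Walk x x)
    -- The boundary of a one-dimensional cell is `{1, -1}`: a segment starting at `-1` either runs
    -- along the whole edge or is constant.
    · have hz0 : |z 0| = 1 := by
        have : z = fun _ => z 0 := funext fun i => by rw [Subsingleton.elim i 0]
        rwa [this, pi_norm_const, Real.norm_eq_abs] at hz
      rcases (abs_eq zero_le_one).1 hz0 with h | h
      · obtain rfl : z = fun _ => 1 := funext fun i => by rw [Subsingleton.elim i 0, h]
        exact hΔ.isWalkClass_diskPath c _ _
      · obtain rfl : z = fun _ => -1 := funext fun i => by rw [Subsingleton.elim i 0, h]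
        rw [Attach.diskPath_self]
        exact .mk (.nil : Δ.Walk _ _)
  obtain ⟨w⟩ := key
  exact ⟨w, rfl⟩

end IsEquivariantGraph

end Presentation

end Shortcut

namespace Shortcut

open Set Metric Topology CategoryTheory
open scoped unitInterval

/-! ### The simply connected complex and its quotient. -/

namespace IsEquivariantGraph

variable {G T : Type u} [Group G] {Δ : SimpleGraph (FreeSet G T)} {color : T → Fin 3}
  (hΔ : IsEquivariantGraph Δ color) (N : ℕ)

/-- The attaching maps of the two-cells along the translates of the short closed walks. -/
noncomputable def coverCell (c : FreeSet G (BasedLoop Δ N)) : AttachingMap 2 (CoverSkel Δ color) :=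
  (loopAttach (hΔ.walkPath c.orb.walk)).comp (c.elt • ·) (coverSkel_continuous_smul c.elt)

lemma coverCell_smul (k : G) (c : FreeSet G (BasedLoop Δ N)) (x : Fin 2 → ℝ) :
    hΔ.coverCell N (k • c) x = k • hΔ.coverCell N c x := mul_smul _ _ _

/-- The simply connected two-dimensional complex of a graph with a free action, which is obtained
by attaching two-cells along the short closed walks. -/
abbrev CoverComplex := Attach (hΔ.coverCell N)

/-- Short closed walks are null-homotopic. -/
lemma mk_map_walkPath_eq_refl {x : FreeSet G T} (w : Δ.Walk x x) (hw : w.length ≤ N) :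
    Path.Homotopic.Quotient.mk ((hΔ.walkPath w).map
      (Attach.continuous_base (φ := hΔ.coverCell N))) = .refl _ := by
  -- The walk is translated into the fundamental domain; the translate by `x.elt` of the
  -- corresponding two-cell then bounds the original walk.
  let b : BasedLoop Δ N :=
    ⟨x.elt⁻¹ • x, w.map (hΔ.smulHom x.elt⁻¹), inv_mul_cancel _,
      (SimpleGraph.Walk.length_map _ _).trans_le hw⟩
  refine Attach.mk_map_base_eq_refl (b := ⟨x.elt, b⟩) _ fun t => ?_
  change x.elt • loopAttach (hΔ.walkPath b.walk) (squareLoop t) = _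
  rw [loopAttach_squareLoop]
  exact (congrArg _ (hΔ.smul_walkPath x.elt⁻¹ w t)).trans (smul_inv_smul _ _)

/-- The vertices as objects of the fundamental groupoid. -/
def vertexObj (x : FreeSet G T) : FundamentalGroupoid (hΔ.CoverComplex N) := ⟨.base (.base x)⟩

/-- The edges as morphisms of the fundamental groupoid. -/
noncomputable def edgeHom {x y : FreeSet G T} (h : Δ.Adj x y) :
    hΔ.vertexObj N x ⟶ hΔ.vertexObj N y :=
  FundamentalGroupoid.fromPath
    (.mk ((hΔ.edgePath h).map (Attach.continuous_base (φ := hΔ.coverCell N))))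

lemma walkHom_eq_fromPath {x y : FreeSet G T} (w : Δ.Walk x y) :
    walkHom (hΔ.vertexObj N) (hΔ.edgeHom N) w = FundamentalGroupoid.fromPath
      (.mk ((hΔ.walkPath w).map (Attach.continuous_base (φ := hΔ.coverCell N)))) := by
  induction w with
  | nil => rfl
  | cons h w ih =>
    rw [walkHom, ih, walkPath, Path.map_trans]
    rfl

lemma pathConnectedSpace (hc : Δ.Connected) : PathConnectedSpace (hΔ.CoverComplex N) := by
  obtain ⟨x₀⟩ := hc.nonempty
  have h0 : ∀ y : CoverSkel Δ color, Joined y (.base x₀) := by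
    have hv : ∀ x, Joined (.base x : CoverSkel Δ color) (.base x₀) := fun x =>
      ⟨hΔ.walkPath (hc.preconnected x x₀).some⟩
    have hp₀ : ‖(fun _ => 1 : Fin 1 → ℝ)‖ = 1 := by simp
    rintro (x | ⟨c, z⟩)
    · exact hv x
    · exact Joined.trans ⟨Attach.tether hp₀ (.cell c z)⟩ (hv _)
  have h1 : ∀ p : hΔ.CoverComplex N, Joined p (.base (.base x₀)) := by
    have hy : ∀ y, Joined (.base y : hΔ.CoverComplex N) (.base (.base x₀)) := fun y =>
      ⟨(h0 y).somePath.map Attach.continuous_base⟩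
    have hp₀ : ‖(fun _ => 1 : Fin 2 → ℝ)‖ = 1 := by simp
    rintro (y | ⟨c, z⟩)
    · exact hy y
    · exact Joined.trans ⟨Attach.tether hp₀ (.cell c z)⟩ (hy _)
  exact ⟨⟨.base (.base x₀)⟩, fun p q => (h1 p).trans (h1 q).symm⟩

/-- If the graph is shortcut, then the two-cells along the short closed walks make it simply
connected. -/
theorem simplyConnectedSpace {θ : ℕ} (hc : Δ.Connected)
    (hθ : ∀ n : ℕ, 1 ≤ n → ∀ f : Cycle Δ n, f.IsIsometric → n ≤ θ) (hN : θ ≤ N) (hN2 : 2 ≤ N) :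
    SimplyConnectedSpace (hΔ.CoverComplex N) := by
  have hpc := hΔ.pathConnectedSpace N hc
  refine simply_connected_iff_loops_nullhomotopic.2 ⟨hpc, fun p γ => ?_⟩
  obtain ⟨x₀⟩ := hc.nonempty
  have hvert : ∀ δ : Path.Homotopic.Quotient (.base (.base x₀) : hΔ.CoverComplex N)
      (.base (.base x₀)), δ = .refl _ := by
    intro δ
    -- The loop is deformed off the two-cells and then to a closed walk, which is trivial because
    -- the short closed walks are.
    obtain ⟨δ, rfl⟩ := Attach.exists_eq_mk_map_base le_rfl δ
    obtain ⟨w, hw⟩ := hΔ.exists_eq_mk_walkPath (.mk δ)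
    have h1 := walkHom_eq_id_of_short (hΔ.vertexObj N) (hΔ.edgeHom N) hc hθ hN hN2
      (fun x w hw => by
        rw [walkHom_eq_fromPath, mk_map_walkPath_eq_refl hΔ N w hw]
        rfl) w
    rw [walkHom_eq_fromPath] at h1
    have h2 : Path.Homotopic.Quotient.mk
        (δ.map (Attach.continuous_base (φ := hΔ.coverCell N))) =
        .mk ((hΔ.walkPath w).map (Attach.continuous_base (φ := hΔ.coverCell N))) :=
      Path.Homotopic.Quotient.eq.2
        ((Path.Homotopic.Quotient.eq.1 hw).map ⟨_, Attach.continuous_base⟩)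
    exact h2.trans h1
  -- A loop at an arbitrary point is conjugated to the vertex `x₀`.
  let ρ : Path (.base (.base x₀)) p := hpc.somePath _ _
  have h3 := hvert (((Path.Homotopic.Quotient.mk ρ).trans (.mk γ)).trans
    (Path.Homotopic.Quotient.mk ρ).symm)
  refine Path.Homotopic.Quotient.eq.1 ?_
  calc Path.Homotopic.Quotient.mk γ
      = ((Path.Homotopic.Quotient.mk ρ).symm.trans (((Path.Homotopic.Quotient.mk ρ).trans
        (.mk γ)).trans (Path.Homotopic.Quotient.mk ρ).symm)).trans (.mk ρ) := by
        rw [← Path.Homotopic.Quotient.trans_assoc, ← Path.Homotopic.Quotient.trans_assoc,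
          Path.Homotopic.Quotient.symm_trans, Path.Homotopic.Quotient.refl_trans,
          Path.Homotopic.Quotient.trans_assoc, Path.Homotopic.Quotient.symm_trans,
          Path.Homotopic.Quotient.trans_refl]
    _ = Path.Homotopic.Quotient.refl p := by
        rw [h3, Path.Homotopic.Quotient.trans_refl, Path.Homotopic.Quotient.symm_trans]

section Quotient

variable [TopologicalSpace T] [DiscreteTopology T]

/-- The attaching maps of the two-cells of the quotient complex. -/
noncomputable def baseCell (b : BasedLoop Δ N) : AttachingMap 2 (BaseSkel Δ color) :=
  (loopAttach (hΔ.walkPath b.walk)).comp (skelMap Δ color)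
    isQuotientCoveringMap_skelMap.continuous

/-- The quotient of the two-dimensional complex of a graph with a free action. -/
abbrev BaseComplex := Attach (hΔ.baseCell N)

/-- The boundary of a translated cell differs from that of its representative by an element of `G`,
which the quotient map forgets. -/
lemma baseCell_orb (c : FreeSet G (BasedLoop Δ N)) (x : Fin 2 → ℝ) :
    hΔ.baseCell N c.orb x = skelMap Δ color (hΔ.coverCell N c x) :=
  (isQuotientCoveringMap_skelMap (Δ := Δ) (color := color)).apply_eq_iff_mem_orbit.2
    ⟨c.elt⁻¹, inv_smul_smul _ _⟩

/-- The universal covering map. -/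
noncomputable def coverMap : hΔ.CoverComplex N → hΔ.BaseComplex N :=
  Attach.map _ (skelMap Δ color)

lemma isQuotientCoveringMap_coverMap : IsQuotientCoveringMap (hΔ.coverMap N) G :=
  Attach.isQuotientCoveringMap_map isQuotientCoveringMap_skelMap (hΔ.coverCell_smul N)
    (hΔ.baseCell_orb N)

lemma isUniversalCover [SimplyConnectedSpace (hΔ.CoverComplex N)] :
    IsUniversalCover (hΔ.coverMap N) where
  t2 := inferInstance
  simplyConnected := inferInstance
  isCoveringMap := (hΔ.isQuotientCoveringMap_coverMap N).isCoveringMap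
  surjective := (hΔ.isQuotientCoveringMap_coverMap N).surjective
  map_cell n e := match n, e with
    | 0, v => ⟨FreeSet.orb (G := G) (T := T) v, fun _ _ => rfl⟩
    | 1, c => ⟨FreeSet.orb (G := G) (T := OrientedEdge Δ color) c, fun x _ =>
        congrArg Attach.base (Attach.map_char orb_coverEdge c x)⟩
    | 2, c => ⟨FreeSet.orb (G := G) (T := BasedLoop Δ N) c, fun x _ =>
        Attach.map_char (hΔ.baseCell_orb N) c x⟩
    | _ + 3, c => c.elim

end Quotient

/-- The presentation complex of a group which acts freely on a shortcut graph. -/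
theorem exists_complex (hΔ : IsEquivariantGraph Δ color) [Finite T] {θ : ℕ} (hc : Δ.Connected)
    (hθ : ∀ n : ℕ, 1 ≤ n → ∀ f : Cycle Δ n, f.IsIsometric → n ≤ θ) :
    ∃ (X : Type u) (_ : TopologicalSpace X) (_ : CWComplex (univ : Set X)),
      IsCompactTwoComplex X ∧ PathConnectedSpace X ∧
      (∀ x : X, Nonempty (FundamentalGroup X x ≃* G)) ∧
      ∃ (E : Type u) (_ : TopologicalSpace E) (_ : CWComplex (univ : Set E)) (p : E → X),
        IsUniversalCover p ∧ (CWComplex.OneSkeletonGraph (univ : Set E)).Simple ∧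
        Nonempty (Δ ≃g (CWComplex.OneSkeletonGraph (univ : Set E)).toSimpleGraph) := by
  let _ : TopologicalSpace T := ⊥
  have : DiscreteTopology T := ⟨rfl⟩
  have := hΔ.finite_orientedEdge
  have := hΔ.finite_basedLoop (max θ 2)
  have := hΔ.simplyConnectedSpace (max θ 2) hc hθ (le_max_left _ _) (le_max_right _ _)
  have hq := hΔ.isQuotientCoveringMap_coverMap (max θ 2)
  refine ⟨hΔ.BaseComplex (max θ 2), inferInstance, inferInstance, isCompactTwoComplex _,
    hq.surjective.pathConnectedSpace hq.continuous, fun x => ?_,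
    hΔ.CoverComplex (max θ 2), inferInstance, inferInstance, hΔ.coverMap (max θ 2),
    hΔ.isUniversalCover (max θ 2), oneSkeletonGraph_simple _ hΔ.adj_iff eq_of_coverSrc,
    ⟨oneSkeletonIso _ hΔ.adj_iff⟩⟩
  obtain ⟨e, he⟩ := hq.surjective x
  -- The covering identifies the fundamental group with the opposite of `G`, and inversion
  -- identifies the latter with `G`.
  exact ⟨(hq.fundamentalGroupEquiv ⟨e, he⟩).trans (MulEquiv.inv' G).symm⟩

end IsEquivariantGraph

lemma _root_.SimpleGraph.Iso.dist_le {V W : Type*} {Γ : SimpleGraph V} {Δ : SimpleGraph W}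
    (hΓ : Γ.Connected) (e : Γ ≃g Δ) (x y : W) : Δ.dist x y ≤ Γ.dist (e.symm x) (e.symm y) := by
  simpa using dist_map_le hΓ e.toHom (e.symm x) (e.symm y)

/-- An isomorphism does not decrease any distance, so the lifting criterion applies to its inverse.
-/
lemma IsShortcutGraph.iso {V W : Type u} {Γ : SimpleGraph V} {Δ : SimpleGraph W}
    (hΓ : IsShortcutGraph Γ) (e : Γ ≃g Δ) : IsShortcutGraph Δ :=
  hΓ.of_hom (e.connected_iff.1 hΓ.1) e.symm.toHom
    fun x y => (e.dist_le hΓ.1 x y).trans (le_max_left _ _)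

lemma IsStronglyShortcutGraph.iso {V W : Type u} {Γ : SimpleGraph V} {Δ : SimpleGraph W}
    (hΓ : IsStronglyShortcutGraph Γ) (e : Γ ≃g Δ) : IsStronglyShortcutGraph Δ :=
  hΓ.of_hom (e.connected_iff.1 hΓ.1) e.symm.toHom
    fun x y => (e.dist_le hΓ.1 x y).trans (le_max_left _ _)

end Shortcut

theorem mainTheorem1 (G : Type u) [Group G] :
    (Shortcut.IsShortcutGroup G →
      (∃ (X : Type u) (_ : TopologicalSpace X) (_ : Topology.CWComplex (Set.univ : Set X)),
        Shortcut.IsCompactTwoComplex X ∧ PathConnectedSpace X ∧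
        (∀ x : X, Nonempty (FundamentalGroup X x ≃* G)) ∧
        ∃ (E : Type u) (_ : TopologicalSpace E) (_ : Topology.CWComplex (Set.univ : Set E))
          (p : E → X), Shortcut.IsUniversalCover p ∧ Shortcut.HasShortcutOneSkeleton E) ∧
      Group.IsFinitelyPresented G) ∧
    (Shortcut.IsStronglyShortcutGroup G →
      (∃ (X : Type u) (_ : TopologicalSpace X) (_ : Topology.CWComplex (Set.univ : Set X)),
        Shortcut.IsCompactTwoComplex X ∧ PathConnectedSpace X ∧
        (∀ x : X, Nonempty (FundamentalGroup X x ≃* G)) ∧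
        ∃ (E : Type u) (_ : TopologicalSpace E) (_ : Topology.CWComplex (Set.univ : Set E))
          (p : E → X), Shortcut.IsUniversalCover p ∧ Shortcut.HasStronglyShortcutOneSkeleton E) ∧
      Group.IsFinitelyPresented G) := by
  constructor
  · intro h
    obtain ⟨T, _, Δ, color, hΔ, hs⟩ := h.exists_equivariantGraph
    obtain ⟨X, tX, cX, h1, h2, h3, E, tE, cE, p, h4, h5, ⟨e⟩⟩ := hΔ.exists_complex hs.1
      hs.2.choose_spec
    exact ⟨⟨X, tX, cX, h1, h2, h3, E, tE, cE, p, h4, h5, hs.iso e⟩, hΔ.isFinitelyPresented hs⟩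
  · intro h
    obtain ⟨T, _, Δ, color, hΔ, hs⟩ := h.exists_equivariantGraph
    have hs' := hs.isShortcutGraph
    obtain ⟨X, tX, cX, h1, h2, h3, E, tE, cE, p, h4, h5, ⟨e⟩⟩ :=
      hΔ.exists_complex hs'.1 hs'.2.choose_spec
    exact ⟨⟨X, tX, cX, h1, h2, h3, E, tE, cE, p, h4, h5, hs.iso e⟩, hΔ.isFinitelyPresented hs'⟩
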